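/- Let $(M,g)$ be a smooth compact Riemannian manifold (without boundary) of dimension $n\ge 6$, with Ricci tensor $Rc$, scalar curvature $R$ and Riemannian volume measure $\mu$. Put $$J=\frac{R}{2(n-1)},\qquad A=\frac{1}{n-2}\,(Rc-Jg),\qquad \sigma_2(A)=\tfrac12\left(J^2-|A|^2\right),\qquad Q=-\Delta J-2|A|^2+\tfrac n2J^2,$$ and let $$P\varphi=\Delta^2\varphi+\operatorname{div}\bigl(4A(\nabla\varphi,e_i)e_i-(n-2)J\nabla\varphi\bigr)+\tfrac{n-4}{2}Q\varphi$$ be the Paneitz operator, where $e_1,\dots,e_n$ is a local orthonormal frame and repeated indices are summed. Let $0\le\lambda\le4$ and suppose that $Q-\lambda\sigma_2(A)>0$ and $J>0$ everywhere on $M$. Then the operator $$H\varphi=P\varphi-\tfrac{n+4}{2}Q\varphi+\lambda\bigl(J\Delta\varphi-\langle A,D^2\varphi\rangle+4\sigma_2(A)\varphi\bigr)+\tfrac{n+4}{2}\bigl(Q-\lambda\sigma_2(A)\bigr)\varphi$$ is positive definite; that is, it is symmetric, $\int_M H\varphi\cdot\psi\,d\mu=\int_M\varphi\cdot H\psi\,d\mu$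 for all $\varphi,\psi\in C^\infty(M)$, and its first eigenvalue is positive: there is a constant $c>0$ such that $$\int_M H\varphi\cdot\varphi\,d\mu\ \ge\ c\int_M\varphi^2\,d\mu\qquad\text{for all }\varphi\in C^\infty(M).$$ -/

import Mathlib

open MeasureTheory
open scoped Manifold ContDiff Matrix

noncomputable section

namespace PaneitzH

/-! ### Riemannian geometry in coordinates

`G : E n → Matrix (Fin n) (Fin n) ℝ` is the matrix `(g_ij)` of a metric in a coordinate system.
Upper indices of the inverse metric are written `(G y)⁻¹ i j`. -/

/-- The coordinate space `ℝⁿ`. -/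
abbrev E (n : ℕ) : Type := EuclideanSpace ℝ (Fin n)

variable {n : ℕ}

/-- The coordinate partial derivative `∂_i f`. -/
def pd (i : Fin n) (f : E n → ℝ) (y : E n) : ℝ :=
  fderiv ℝ f y (EuclideanSpace.single i 1)

/-- The Christoffel symbol `Γ^k_{ij}` of the Levi-Civita connection. -/
def christoffel (G : E n → Matrix (Fin n) (Fin n) ℝ) (k i j : Fin n) (y : E n) : ℝ :=
  (1 / 2) * ∑ l, (G y)⁻¹ k l *
    (pd i (fun z => G z j l) y + pd j (fun z => G z i l) y - pd l (fun z => G z i j) y)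

/-- The Ricci tensor
`Rc_{ij} = ∂_k Γ^k_{ij} - ∂_j Γ^k_{ik} + Γ^k_{kl} Γ^l_{ij} - Γ^k_{jl} Γ^l_{ik}`
(with this sign it is positive on round spheres). -/
def ricci (G : E n → Matrix (Fin n) (Fin n) ℝ) (i j : Fin n) (y : E n) : ℝ :=
  ∑ k, (pd k (christoffel G k i j) y - pd j (christoffel G k i k) y) +
    ∑ k, ∑ l, (christoffel G k k l y * christoffel G l i j y -
      christoffel G k j l y * christoffel G l i k y)

/-- The scalar curvature `R = g^{ij} Rc_{ij}`. -/
def scalarCurv (G : E n → Matrix (Fin n) (Fin n) ℝ) (y : E n) : ℝ :=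
  ∑ i, ∑ j, (G y)⁻¹ i j * ricci G i j y

/-- `J = R / (2 (n - 1))`. -/
def locJ (G : E n → Matrix (Fin n) (Fin n) ℝ) (y : E n) : ℝ :=
  scalarCurv G y / (2 * ((n : ℝ) - 1))

/-- The Schouten tensor `A = (Rc - J g) / (n - 2)`, lower indices. -/
def schouten (G : E n → Matrix (Fin n) (Fin n) ℝ) (i j : Fin n) (y : E n) : ℝ :=
  (1 / ((n : ℝ) - 2)) * (ricci G i j y - locJ G y * G y i j)

/-- The full contraction `g^{ik} g^{jl} S_{ij} T_{kl}` of two covariant 2-tensors at `y`. -/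
def contract (G : E n → Matrix (Fin n) (Fin n) ℝ) (S T : Fin n → Fin n → ℝ) (y : E n) : ℝ :=
  ∑ i, ∑ j, ∑ k, ∑ l, (G y)⁻¹ i k * (G y)⁻¹ j l * S i j * T k l

/-- `σ₂(A) = (J² - |A|²) / 2`. -/
def locSigmaTwo (G : E n → Matrix (Fin n) (Fin n) ℝ) (y : E n) : ℝ :=
  (1 / 2) * (locJ G y ^ 2 -
    contract G (fun i j => schouten G i j y) (fun i j => schouten G i j y) y)

/-- The Hessian `(D²f)_{ij} = ∂_i ∂_j f - Γ^k_{ij} ∂_k f`. -/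
def hess (G : E n → Matrix (Fin n) (Fin n) ℝ) (f : E n → ℝ) (i j : Fin n) (y : E n) : ℝ :=
  pd i (pd j f) y - ∑ k, christoffel G k i j y * pd k f y

/-- The Laplace–Beltrami operator `Δf = g^{ij} (D²f)_{ij}`. -/
def lap (G : E n → Matrix (Fin n) (Fin n) ℝ) (f : E n → ℝ) (y : E n) : ℝ :=
  ∑ i, ∑ j, (G y)⁻¹ i j * hess G f i j y

/-- The gradient `(∇f)^i = g^{ij} ∂_j f`. -/
def grad (G : E n → Matrix (Fin n) (Fin n) ℝ) (f : E n → ℝ) (i : Fin n) (y : E n) : ℝ :=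
  ∑ j, (G y)⁻¹ i j * pd j f y

/-- The divergence `div X = ∂_i X^i + Γ^i_{ij} X^j`. -/
def divg (G : E n → Matrix (Fin n) (Fin n) ℝ) (X : Fin n → E n → ℝ) (y : E n) : ℝ :=
  ∑ i, pd i (X i) y + ∑ i, ∑ j, christoffel G i i j y * X j y

/-- The `Q` curvature `Q = -ΔJ - 2|A|² + (n/2) J²`. -/
def locQ (G : E n → Matrix (Fin n) (Fin n) ℝ) (y : E n) : ℝ :=
  -lap G (locJ G) y
    - 2 * contract G (fun i j => schouten G i j y) (fun i j => schouten G i j y) y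
    + ((n : ℝ) / 2) * locJ G y ^ 2

/-- The vector field `A(∇f, e_a) e_a` (`e_a` an orthonormal frame); in coordinates, its `i`-th
component is `g^{ij} A_{jk} (∇f)^k`. -/
def schoutenGrad (G : E n → Matrix (Fin n) (Fin n) ℝ) (f : E n → ℝ) (i : Fin n) (y : E n) : ℝ :=
  ∑ j, ∑ k, (G y)⁻¹ i j * schouten G j k y * grad G f k y

/-- The Paneitz operator
`Pf = Δ²f + div (4 A(∇f, e_a) e_a - (n - 2) J ∇f) + ((n - 4)/2) Q f`. -/
def locP (G : E n → Matrix (Fin n) (Fin n) ℝ) (f : E n → ℝ) (y : E n) : ℝ :=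
  lap G (lap G f) y
    + divg G (fun i z => 4 * schoutenGrad G f i z - ((n : ℝ) - 2) * locJ G z * grad G f i z) y
    + (((n : ℝ) - 4) / 2) * locQ G y * f y

/-- The operator `Hf = Pf - ((n+4)/2) Q f + λ (J Δf - ⟨A, D²f⟩ + 4 σ₂(A) f)
+ ((n+4)/2) (Q - λ σ₂(A)) f`. -/
def locH (G : E n → Matrix (Fin n) (Fin n) ℝ) (lam : ℝ) (f : E n → ℝ) (y : E n) : ℝ :=
  locP G f y - (((n : ℝ) + 4) / 2) * locQ G y * f y
    + lam * (locJ G y * lap G f y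
        - contract G (fun i j => schouten G i j y) (fun i j => hess G f i j y) y
        + 4 * locSigmaTwo G y * f y)
    + (((n : ℝ) + 4) / 2) * (locQ G y - lam * locSigmaTwo G y) * f y

/-! ### Riemannian manifolds -/

variable {M : Type*} [TopologicalSpace M] [ChartedSpace (E n) M] [IsManifold (𝓡 n) ∞ M]

/-- Smooth Riemannian metrics on `M`. -/
abbrev SmoothMetric (n : ℕ) (M : Type*) [TopologicalSpace M] [ChartedSpace (E n) M]
    [IsManifold (𝓡 n) ∞ M] : Type _ :=
  Bundle.ContMDiffRiemannianMetric (𝓡 n) ∞ (E n) (fun x : M => TangentSpace (𝓡 n) x)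

/-- The coordinate vector field `∂_i` of the preferred chart at `c`, at the point with
coordinates `y`. -/
def coordVec (c : M) (i : Fin n) (y : E n) :
    TangentSpace (𝓡 n) ((extChartAt (𝓡 n) c).symm y) :=
  mfderiv 𝓘(ℝ, E n) (𝓡 n) (extChartAt (𝓡 n) c).symm y (EuclideanSpace.single i (1 : ℝ) : E n)

/-- The matrix `g_ij = g(∂_i, ∂_j)` of the metric in the preferred chart at `c`, as a function of
the coordinates. -/
def metricInChart (g : SmoothMetric n M) (c : M) (y : E n) : Matrix (Fin n) (Fin n) ℝ :=
  Matrix.of fun i j =>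
    g.inner ((extChartAt (𝓡 n) c).symm y) (coordVec c i y) (coordVec c j y)

/-! The following scalars are independent of the coordinates in which they are computed; at the
point `x` the preferred chart at `x` is used. -/

/-- `J = R / (2 (n - 1))` as a function on `M`. -/
def J (g : SmoothMetric n M) (x : M) : ℝ :=
  locJ (metricInChart g x) (extChartAt (𝓡 n) x x)

/-- `σ₂(A)` as a function on `M`. -/
def sigmaTwo (g : SmoothMetric n M) (x : M) : ℝ :=
  locSigmaTwo (metricInChart g x) (extChartAt (𝓡 n) x x)

/-- The `Q` curvature as a function on `M`. -/
def Q (g : SmoothMetric n M) (x : M) : ℝ :=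
  locQ (metricInChart g x) (extChartAt (𝓡 n) x x)

/-- The fourth-order operator `H` on functions on `M`. -/
def H (g : SmoothMetric n M) (lam : ℝ) (f : M → ℝ) (x : M) : ℝ :=
  locH (metricInChart g x) lam (f ∘ (extChartAt (𝓡 n) x).symm) (extChartAt (𝓡 n) x x)

/-- The coordinate volume `√(det g_ij) dy¹ ⋯ dyⁿ` of the preferred chart at `c`, transported to
the domain of that chart and extended by zero to `M`. -/
def chartVolume [MeasurableSpace M] (g : SmoothMetric n M) (c : M) : Measure M :=
  (((volume : Measure (E n)).restrict (extChartAt (𝓡 n) c).target).withDensity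
    (fun y => ENNReal.ofReal (Real.sqrt (metricInChart g c y).det))).map (extChartAt (𝓡 n) c).symm

/-- The Riemannian volume measure `μ` of `g`: the least measure on `M` that dominates the
coordinate volume of every chart. The coordinate volumes agree on overlaps of charts, so the
restriction of `μ` to each chart domain is the coordinate volume. -/
def vol [MeasurableSpace M] (g : SmoothMetric n M) : Measure M :=
  ⨆ c : M, chartVolume g c

/-- A linear differential operator `T` on a closed Riemannian manifold is positive definite if it
is symmetric in `L²` and its first eigenvalue, the infimum of `∫ Tφ · φ / ∫ φ²`, is positive. -/
def IsPositiveDefinite [MeasurableSpace M] (g : SmoothMetric n M) (T : (M → ℝ) → M → ℝ) : Prop :=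
  (∀ φ ψ : M → ℝ, ContMDiff (𝓡 n) 𝓘(ℝ, ℝ) ∞ φ → ContMDiff (𝓡 n) 𝓘(ℝ, ℝ) ∞ ψ →
    ∫ x, T φ x * ψ x ∂(vol g) = ∫ x, φ x * T ψ x ∂(vol g)) ∧
  ∃ c : ℝ, 0 < c ∧ ∀ φ : M → ℝ, ContMDiff (𝓡 n) 𝓘(ℝ, ℝ) ∞ φ →
    c * ∫ x, φ x ^ 2 ∂(vol g) ≤ ∫ x, T φ x * φ x ∂(vol g)

end PaneitzH

end

/-!
By the contracted Bianchi identity `div A = dJ`, `H` is in divergence form: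
`Hφ = div (∇Δφ + (4 - λ) A(∇φ) - (n - 2 - λ) J ∇φ) + ((n - 4)/2) (Q - λ σ₂(A)) φ`.
Integrate against `ψ` and put `t = (4 - λ)/(n - 2)`. Since `Rc = (n - 2) A + J g`, applying
Bochner's formula to the fraction `t` of `∫ Δφ Δψ` cancels the Schouten term, so `∫ Hφ · ψ` is the
integral of
`(1 - t) Δφ Δψ + t ⟨D²φ, D²ψ⟩ + (t + n - 2 - λ) J ⟨∇φ, ∇ψ⟩ + ((n - 4)/2) (Q - λ σ₂(A)) φ ψ`.
This is symmetric in `φ` and `ψ`; every coefficient is nonnegative and the last one is bounded below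
by a positive constant.

All the local quantities are invariant under pullback by local diffeomorphisms, so the pointwise
identities need only be checked at the centre of coordinates in which the first derivatives of the
metric vanish.
-/

noncomputable section

namespace PaneitzH

/-! ### Calculus on open sets -/

section Calculus

variable {X Y : Type*} [NormedAddCommGroup X] [NormedSpace ℝ X] [NormedAddCommGroup Y]
  [NormedSpace ℝ Y] {U : Set X} {F F' : X → Y} {x : X}

lemma differentiableAt_of_contDiffOn (hU : IsOpen U) (hF : ContDiffOn ℝ ∞ F U) (hx : x ∈ U) :
    DifferentiableAt ℝ F x :=
  (hF.contDiffAt (hU.mem_nhds hx)).differentiableAt (by simp)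

lemma contDiffOn_fderiv (hU : IsOpen U) (hF : ContDiffOn ℝ ∞ F U) :
    ContDiffOn ℝ ∞ (fderiv ℝ F) U :=
  hF.fderiv_of_isOpen hU (by simp)

lemma eqOn_fderiv (hU : IsOpen U) (h : Set.EqOn F F' U) :
    Set.EqOn (fderiv ℝ F) (fderiv ℝ F') U := fun _ hx =>
  (h.eventuallyEq_of_mem (hU.mem_nhds hx)).fderiv_eq

lemma fderiv_apply_const {F : X → X →L[ℝ] Y} (hF : DifferentiableAt ℝ F x) (u v : X) :
    fderiv ℝ (fun z => F z u) x v = fderiv ℝ F x v u := by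
  simp [fderiv_clm_apply hF (differentiableAt_const u)]

lemma fderiv_apply₂ {F : X → X →L[ℝ] X →L[ℝ] Y} {u v : X → X} (hF : DifferentiableAt ℝ F x)
    (hu : DifferentiableAt ℝ u x) (hv : DifferentiableAt ℝ v x) (w : X) :
    fderiv ℝ (fun z => F z (u z) (v z)) x w =
      fderiv ℝ F x w (u x) (v x) + F x (fderiv ℝ u x w) (v x) + F x (u x) (fderiv ℝ v x w) := by
  rw [((hF.hasFDerivAt.clm_apply hu.hasFDerivAt).clm_apply hv.hasFDerivAt).fderiv]
  simp [add_comm]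

lemma fderiv_apply₂_const {F : X → X →L[ℝ] X →L[ℝ] Y} (hF : DifferentiableAt ℝ F x)
    (u v w : X) : fderiv ℝ (fun z => F z u v) x w = fderiv ℝ F x w u v := by
  simp [fderiv_apply₂ hF (differentiableAt_const u) (differentiableAt_const v)]

lemma fderiv_fderiv_comm (hU : IsOpen U) (hF : ContDiffOn ℝ ∞ F U) (hx : x ∈ U) (u v : X) :
    fderiv ℝ (fderiv ℝ F) x u v = fderiv ℝ (fderiv ℝ F) x v u :=
  ((hF.contDiffAt (hU.mem_nhds hx)).isSymmSndFDerivAt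
    (by simpa only [minSmoothness_of_isRCLikeNormedField] using ENat.LEInfty.out)).eq u v

lemma fderiv_fderiv_fderiv_comm (hU : IsOpen U) (hF : ContDiffOn ℝ ∞ F U) (hx : x ∈ U)
    (u v w : X) : fderiv ℝ (fderiv ℝ (fderiv ℝ F)) x u v w =
      fderiv ℝ (fderiv ℝ (fderiv ℝ F)) x w v u := by
  have hF' := contDiffOn_fderiv hU hF
  have hD := differentiableAt_of_contDiffOn hU (contDiffOn_fderiv hU hF') hx
  have hlast : ∀ u v w, fderiv ℝ (fderiv ℝ (fderiv ℝ F)) x u v w =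
      fderiv ℝ (fderiv ℝ (fderiv ℝ F)) x u w v := fun u v w => by
    rw [← fderiv_apply₂_const hD, ← fderiv_apply₂_const hD,
      eqOn_fderiv hU (fun z hz => fderiv_fderiv_comm hU hF hz v w) hx]
  rw [fderiv_fderiv_comm hU hF' hx u v, hlast v u w, fderiv_fderiv_comm hU hF' hx v w]

lemma contDiffOn_smul_const {f : X → ℝ} (hf : ContDiffOn ℝ ∞ f U) (w : Y) :
    ContDiffOn ℝ ∞ (fun x => f x • w) U :=
  hf.smul contDiffOn_const

lemma contDiffOn_det {ι : Type*} [Fintype ι] [DecidableEq ι] {A : X → Matrix ι ι ℝ}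
    (hA : ∀ i j, ContDiffOn ℝ ∞ (fun z => A z i j) U) :
    ContDiffOn ℝ ∞ (fun z => (A z).det) U := by
  simp only [Matrix.det_apply]
  exact ContDiffOn.sum fun σ _ => (contDiffOn_prod fun i _ => hA _ _).const_smul _

end Calculus

section PartialDerivatives

variable {n : ℕ} {U : Set (E n)} {f h : E n → ℝ} {y : E n}

/-- The standard basis vector `e_i` of `ℝⁿ`. -/
abbrev stdVec (i : Fin n) : E n := EuclideanSpace.single i (1 : ℝ)

lemma sum_smul_stdVec (u : E n) : ∑ i, u i • stdVec i = u := by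
  simpa using (EuclideanSpace.basisFun (Fin n) ℝ).sum_repr u

lemma contDiffOn_pd (hU : IsOpen U) (hf : ContDiffOn ℝ ∞ f U) (i : Fin n) :
    ContDiffOn ℝ ∞ (pd i f) U :=
  (contDiffOn_fderiv hU hf).clm_apply contDiffOn_const

lemma eqOn_pd (hU : IsOpen U) (hfh : Set.EqOn f h U) (i : Fin n) :
    Set.EqOn (pd i f) (pd i h) U := fun _ hy => by
  rw [pd, pd, eqOn_fderiv hU hfh hy]

lemma pd_const (i : Fin n) (a : ℝ) : pd i (fun _ : E n => a) y = 0 := by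
  simp [pd]

lemma pd_add (hf : DifferentiableAt ℝ f y) (hh : DifferentiableAt ℝ h y) (i : Fin n) :
    pd i (fun z => f z + h z) y = pd i f y + pd i h y := by
  simp [pd, fderiv_fun_add hf hh]

lemma pd_sub (hf : DifferentiableAt ℝ f y) (hh : DifferentiableAt ℝ h y) (i : Fin n) :
    pd i (fun z => f z - h z) y = pd i f y - pd i h y := by
  simp [pd, fderiv_fun_sub hf hh]

lemma pd_mul (hf : DifferentiableAt ℝ f y) (hh : DifferentiableAt ℝ h y) (i : Fin n) :
    pd i (fun z => f z * h z) y = pd i f y * h y + f y * pd i h y := by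
  simp only [pd, fderiv_fun_mul hf hh, add_apply, smul_apply, smul_eq_mul]
  ring

lemma pd_const_mul (hf : DifferentiableAt ℝ f y) (a : ℝ) (i : Fin n) :
    pd i (fun z => a * f z) y = a * pd i f y := by
  rw [pd_mul (differentiableAt_const a) hf, pd_const, zero_mul, zero_add]

lemma pd_sum {ι : Type*} {s : Finset ι} {F : ι → E n → ℝ}
    (hF : ∀ k ∈ s, DifferentiableAt ℝ (F k) y) (i : Fin n) :
    pd i (fun z => ∑ k ∈ s, F k z) y = ∑ k ∈ s, pd i (F k) y := by
  simp [pd, fderiv_fun_sum hF]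

lemma pd_pd_eq_fderiv_fderiv (hU : IsOpen U) (hf : ContDiffOn ℝ ∞ f U) (hy : y ∈ U)
    (i j : Fin n) : pd i (pd j f) y = fderiv ℝ (fderiv ℝ f) y (stdVec i) (stdVec j) :=
  fderiv_apply_const (differentiableAt_of_contDiffOn hU (contDiffOn_fderiv hU hf) hy) _ _

lemma eqOn_pd_comm (hU : IsOpen U) (hf : ContDiffOn ℝ ∞ f U) (i j : Fin n) :
    Set.EqOn (pd i (pd j f)) (pd j (pd i f)) U := fun _ hy => by
  rw [pd_pd_eq_fderiv_fderiv hU hf hy, pd_pd_eq_fderiv_fderiv hU hf hy,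
    fderiv_fderiv_comm hU hf hy]

end PartialDerivatives

/-! ### Riemannian metrics on open subsets of `ℝⁿ` -/

/-- `G` is the matrix of a smooth Riemannian metric on the open set `U` of `ℝⁿ`. -/
structure IsMetricOn {n : ℕ} (G : E n → Matrix (Fin n) (Fin n) ℝ) (U : Set (E n)) : Prop where
  isOpen : IsOpen U
  contDiffOn : ∀ i j, ContDiffOn ℝ ∞ (fun y => G y i j) U
  posDef : ∀ y ∈ U, (G y).PosDef

namespace IsMetricOn

variable {n : ℕ} {U : Set (E n)} {f : E n → ℝ} {G : E n → Matrix (Fin n) (Fin n) ℝ} {y : E n}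

lemma mono (hG : IsMetricOn G U) {V : Set (E n)} (hV : IsOpen V) (h : V ⊆ U) : IsMetricOn G V :=
  ⟨hV, fun i j => (hG.contDiffOn i j).mono h, fun y hy => hG.posDef y (h hy)⟩

lemma differentiableAt {Y : Type*} [NormedAddCommGroup Y] [NormedSpace ℝ Y] {F : E n → Y}
    (hG : IsMetricOn G U) (hF : ContDiffOn ℝ ∞ F U) (hy : y ∈ U) : DifferentiableAt ℝ F y :=
  differentiableAt_of_contDiffOn hG.isOpen hF hy

lemma det_pos (hG : IsMetricOn G U) (hy : y ∈ U) : 0 < (G y).det := (hG.posDef y hy).det_pos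

lemma isUnit_det (hG : IsMetricOn G U) (hy : y ∈ U) : IsUnit (G y).det :=
  (hG.det_pos hy).ne'.isUnit

lemma entry_comm (hG : IsMetricOn G U) (hy : y ∈ U) (i j : Fin n) : G y i j = G y j i := by
  simpa using (hG.posDef y hy).isHermitian.apply j i

lemma inv_entry_comm (hG : IsMetricOn G U) (hy : y ∈ U) (i j : Fin n) :
    (G y)⁻¹ i j = (G y)⁻¹ j i := by
  simpa using (hG.posDef y hy).isHermitian.inv.apply j i

lemma pd_entry_comm (hG : IsMetricOn G U) (hy : y ∈ U) (i j k : Fin n) :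
    pd k (fun z => G z i j) y = pd k (fun z => G z j i) y :=
  eqOn_pd hG.isOpen (fun _ hz => hG.entry_comm hz i j) k hy

lemma contDiffOn_inv (hG : IsMetricOn G U) (i j : Fin n) :
    ContDiffOn ℝ ∞ (fun y => (G y)⁻¹ i j) U := by
  have cramer : ∀ y, (G y)⁻¹ i j = (G y).det⁻¹ * ((G y).updateRow j (Pi.single i 1)).det :=
    fun y => by
      rw [Matrix.inv_def, Ring.inverse_eq_inv', Matrix.smul_apply, Matrix.adjugate_apply,
        smul_eq_mul]
  simp only [cramer]
  refine ((contDiffOn_det hG.contDiffOn).inv fun y hy => (hG.det_pos hy).ne').mul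
    (contDiffOn_det fun k l => ?_)
  obtain rfl | hk := eq_or_ne k j
  · simpa using contDiffOn_const
  · simpa [Matrix.updateRow_ne hk] using hG.contDiffOn k l

lemma contDiffOn_pd_entry (hG : IsMetricOn G U) (k i j : Fin n) :
    ContDiffOn ℝ ∞ (pd k fun z => G z i j) U :=
  contDiffOn_pd hG.isOpen (hG.contDiffOn i j) k

lemma contDiffOn_christoffel (hG : IsMetricOn G U) (k i j : Fin n) :
    ContDiffOn ℝ ∞ (christoffel G k i j) U :=
  contDiffOn_const.mul (ContDiffOn.sum fun l _ => (hG.contDiffOn_inv k l).mul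
    (((hG.contDiffOn_pd_entry _ _ _).add (hG.contDiffOn_pd_entry _ _ _)).sub
      (hG.contDiffOn_pd_entry _ _ _)))

lemma contDiffOn_pd_christoffel (hG : IsMetricOn G U) (m k i j : Fin n) :
    ContDiffOn ℝ ∞ (pd m (christoffel G k i j)) U :=
  contDiffOn_pd hG.isOpen (hG.contDiffOn_christoffel k i j) m

lemma contDiffOn_ricci (hG : IsMetricOn G U) (i j : Fin n) :
    ContDiffOn ℝ ∞ (ricci G i j) U := by
  have hc := hG.contDiffOn_christoffel
  have hp := hG.contDiffOn_pd_christoffel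
  exact (ContDiffOn.sum fun k _ => (hp _ _ _ _).sub (hp _ _ _ _)).add
    (ContDiffOn.sum fun k _ => ContDiffOn.sum fun l _ =>
      ((hc _ _ _).mul (hc _ _ _)).sub ((hc _ _ _).mul (hc _ _ _)))

lemma contDiffOn_trace (hG : IsMetricOn G U) {S : Fin n → Fin n → E n → ℝ}
    (hS : ∀ i j, ContDiffOn ℝ ∞ (S i j) U) :
    ContDiffOn ℝ ∞ (fun y => ∑ i, ∑ j, (G y)⁻¹ i j * S i j y) U :=
  ContDiffOn.sum fun i _ => ContDiffOn.sum fun j _ => (hG.contDiffOn_inv i j).mul (hS i j)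

lemma contDiffOn_scalarCurv (hG : IsMetricOn G U) : ContDiffOn ℝ ∞ (scalarCurv G) U :=
  hG.contDiffOn_trace hG.contDiffOn_ricci

lemma contDiffOn_locJ (hG : IsMetricOn G U) : ContDiffOn ℝ ∞ (locJ G) U :=
  hG.contDiffOn_scalarCurv.div_const _

lemma contDiffOn_schouten (hG : IsMetricOn G U) (i j : Fin n) :
    ContDiffOn ℝ ∞ (schouten G i j) U :=
  contDiffOn_const.mul ((hG.contDiffOn_ricci i j).sub (hG.contDiffOn_locJ.mul (hG.contDiffOn i j)))

lemma contDiffOn_contract (hG : IsMetricOn G U) {S T : Fin n → Fin n → E n → ℝ}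
    (hS : ∀ i j, ContDiffOn ℝ ∞ (S i j) U) (hT : ∀ i j, ContDiffOn ℝ ∞ (T i j) U) :
    ContDiffOn ℝ ∞ (fun y => contract G (fun i j => S i j y) (fun i j => T i j y) y) U :=
  ContDiffOn.sum fun i _ => ContDiffOn.sum fun j _ => ContDiffOn.sum fun k _ =>
    ContDiffOn.sum fun l _ =>
      (((hG.contDiffOn_inv i k).mul (hG.contDiffOn_inv j l)).mul (hS i j)).mul (hT k l)

lemma contDiffOn_locSigmaTwo (hG : IsMetricOn G U) : ContDiffOn ℝ ∞ (locSigmaTwo G) U :=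
  contDiffOn_const.mul ((hG.contDiffOn_locJ.pow 2).sub
    (hG.contDiffOn_contract hG.contDiffOn_schouten hG.contDiffOn_schouten))

lemma contDiffOn_hess (hG : IsMetricOn G U) (hf : ContDiffOn ℝ ∞ f U) (i j : Fin n) :
    ContDiffOn ℝ ∞ (hess G f i j) U :=
  (contDiffOn_pd hG.isOpen (contDiffOn_pd hG.isOpen hf j) i).sub
    (ContDiffOn.sum fun k _ =>
      (hG.contDiffOn_christoffel k i j).mul (contDiffOn_pd hG.isOpen hf k))

lemma contDiffOn_lap (hG : IsMetricOn G U) (hf : ContDiffOn ℝ ∞ f U) :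
    ContDiffOn ℝ ∞ (lap G f) U :=
  hG.contDiffOn_trace (hG.contDiffOn_hess hf)

lemma contDiffOn_grad (hG : IsMetricOn G U) (hf : ContDiffOn ℝ ∞ f U) (i : Fin n) :
    ContDiffOn ℝ ∞ (grad G f i) U :=
  ContDiffOn.sum fun j _ => (hG.contDiffOn_inv i j).mul (contDiffOn_pd hG.isOpen hf j)

lemma contDiffOn_divg (hG : IsMetricOn G U) {X : Fin n → E n → ℝ}
    (hX : ∀ i, ContDiffOn ℝ ∞ (X i) U) : ContDiffOn ℝ ∞ (divg G X) U :=
  (ContDiffOn.sum fun i _ => contDiffOn_pd hG.isOpen (hX i) i).add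
    (ContDiffOn.sum fun i _ => ContDiffOn.sum fun j _ =>
      (hG.contDiffOn_christoffel i i j).mul (hX j))

lemma contDiffOn_locQ (hG : IsMetricOn G U) : ContDiffOn ℝ ∞ (locQ G) U :=
  ((hG.contDiffOn_lap hG.contDiffOn_locJ).neg.sub (contDiffOn_const.mul
    (hG.contDiffOn_contract hG.contDiffOn_schouten hG.contDiffOn_schouten))).add
      (contDiffOn_const.mul (hG.contDiffOn_locJ.pow 2))

lemma contDiffOn_schoutenGrad (hG : IsMetricOn G U) (hf : ContDiffOn ℝ ∞ f U) (i : Fin n) :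
    ContDiffOn ℝ ∞ (schoutenGrad G f i) U :=
  ContDiffOn.sum fun j _ => ContDiffOn.sum fun k _ =>
    ((hG.contDiffOn_inv i j).mul (hG.contDiffOn_schouten j k)).mul (hG.contDiffOn_grad hf k)

lemma contDiffOn_paneitzField (hG : IsMetricOn G U) (hf : ContDiffOn ℝ ∞ f U) (i : Fin n) :
    ContDiffOn ℝ ∞
      (fun y => 4 * schoutenGrad G f i y - ((n : ℝ) - 2) * locJ G y * grad G f i y) U :=
  (contDiffOn_const.mul (hG.contDiffOn_schoutenGrad hf i)).sub
    ((contDiffOn_const.mul hG.contDiffOn_locJ).mul (hG.contDiffOn_grad hf i))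

lemma contDiffOn_locP (hG : IsMetricOn G U) (hf : ContDiffOn ℝ ∞ f U) :
    ContDiffOn ℝ ∞ (locP G f) U :=
  ((hG.contDiffOn_lap (hG.contDiffOn_lap hf)).add
    (hG.contDiffOn_divg (hG.contDiffOn_paneitzField hf))).add
    ((contDiffOn_const.mul hG.contDiffOn_locQ).mul hf)

lemma contDiffOn_locH (hG : IsMetricOn G U) (hf : ContDiffOn ℝ ∞ f U) (lam : ℝ) :
    ContDiffOn ℝ ∞ (locH G lam f) U :=
  (((hG.contDiffOn_locP hf).sub ((contDiffOn_const.mul hG.contDiffOn_locQ).mul hf)).add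
    (contDiffOn_const.mul (((hG.contDiffOn_locJ.mul (hG.contDiffOn_lap hf)).sub
      (hG.contDiffOn_contract hG.contDiffOn_schouten (hG.contDiffOn_hess hf))).add
        ((contDiffOn_const.mul hG.contDiffOn_locSigmaTwo).mul hf)))).add
    ((contDiffOn_const.mul
      (hG.contDiffOn_locQ.sub (contDiffOn_const.mul hG.contDiffOn_locSigmaTwo))).mul hf)

end IsMetricOn

/-! ### Linear algebra in the standard basis -/

section LinearAlgebra

variable {n : ℕ}

lemma eq_zero_of_apply_stdVec {Y : Type*} [AddCommGroup Y] [Module ℝ Y] {L : E n → Y}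
    (hL : IsLinearMap ℝ L) (h : ∀ i, L (stdVec i) = 0) (u : E n) : L u = 0 := by
  have := map_sum hL.mk' (fun i => u i • stdVec i) Finset.univ
  simpa [sum_smul_stdVec, hL.map_smul, h] using this

lemma bilinear_apply_eq_sum (B : E n →ₗ[ℝ] E n →ₗ[ℝ] ℝ) (u v : E n) :
    B u v = ∑ i, ∑ j, B (stdVec i) (stdVec j) * (u i * v j) := by
  conv_lhs => rw [← sum_smul_stdVec u, ← sum_smul_stdVec v]
  simp only [map_sum, map_smul, LinearMap.sum_apply, LinearMap.smul_apply, smul_eq_mul,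
    Finset.mul_sum]
  rw [Finset.sum_comm]
  exact Finset.sum_congr rfl fun i _ => Finset.sum_congr rfl fun j _ => by ring

lemma trace_eq_sum_stdVec (L : E n →ₗ[ℝ] E n) :
    LinearMap.trace ℝ (E n) L = ∑ k, L (stdVec k) k := by
  simp [LinearMap.trace_eq_sum_inner L (EuclideanSpace.basisFun (Fin n) ℝ), PiLp.inner_apply]

lemma trace_eq_of_intertwining {K W : Type*} [Field K] [AddCommGroup W] [Module K W]
    [FiniteDimensional K W] {L L' T : W →ₗ[K] W} (hT : Function.Injective T)
    (h : ∀ w, T (L' w) = L (T w)) : LinearMap.trace K W L' = LinearMap.trace K W L := by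
  let e : W ≃ₗ[K] W := LinearEquiv.ofInjectiveEndo T hT
  have hconj : e.conj L' = L := LinearMap.ext fun x => by
    obtain ⟨w, rfl⟩ := e.surjective x
    rw [LinearEquiv.conj_apply_apply, LinearEquiv.symm_apply_apply]
    exact h w
  rw [← hconj, LinearMap.trace_conj']

end LinearAlgebra

/-! ### The metric, the connection and the curvature as multilinear maps -/

section Tensors

variable {n : ℕ} {U : Set (E n)} {f : E n → ℝ} {G : E n → Matrix (Fin n) (Fin n) ℝ} {y : E n}

/-- The bilinear form `(u, v) ↦ G_{ij} u^i v^j` of the metric with matrix `G`. -/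
def metricForm (G : E n → Matrix (Fin n) (Fin n) ℝ) (y : E n) : E n →L[ℝ] E n →L[ℝ] ℝ :=
  ∑ i, ∑ j, G y i j •
    (EuclideanSpace.proj i : E n →L[ℝ] ℝ).smulRight (EuclideanSpace.proj j : E n →L[ℝ] ℝ)

/-- The Christoffel symbols of `G` as a bilinear map `(u, v) ↦ Γ^k_{ij} u^i v^j e_k`. -/
def connForm (G : E n → Matrix (Fin n) (Fin n) ℝ) (y : E n) : E n →L[ℝ] E n →L[ℝ] E n :=
  ∑ k, ∑ i, ∑ j, christoffel G k i j y •
    (EuclideanSpace.proj i : E n →L[ℝ] ℝ).smulRight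
      ((EuclideanSpace.proj j : E n →L[ℝ] ℝ).smulRight (stdVec k))

/-- The curvature endomorphism `c ↦ R(c, a) b`, whose trace is the Ricci tensor. -/
def curvEndo (G : E n → Matrix (Fin n) (Fin n) ℝ) (y a b : E n) : E n →L[ℝ] E n :=
  ((fderiv ℝ (connForm G) y).flip b).flip a - fderiv ℝ (connForm G) y a b
    + (connForm G y).flip (connForm G y b a) - (connForm G y a).comp (connForm G y b)

/-- The Ricci tensor as a bilinear form. -/
def ricciForm (G : E n → Matrix (Fin n) (Fin n) ℝ) (y : E n) : E n →ₗ[ℝ] E n →ₗ[ℝ] ℝ :=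
  LinearMap.mk₂ ℝ (fun b a => LinearMap.trace ℝ (E n) (curvEndo G y a b))
    (fun b b' a => by rw [← map_add]; congr 1; ext; simp [curvEndo]; ring)
    (fun r b a => by rw [← map_smul]; congr 1; ext; simp [curvEndo]; ring)
    (fun b a a' => by rw [← map_add]; congr 1; ext; simp [curvEndo]; ring)
    (fun r b a => by rw [← map_smul]; congr 1; ext; simp [curvEndo]; ring)

/-- The Hessian of `f` as a bilinear form. -/
def hessForm (G : E n → Matrix (Fin n) (Fin n) ℝ) (f : E n → ℝ) (y : E n) :
    E n →L[ℝ] E n →L[ℝ] ℝ :=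
  fderiv ℝ (fderiv ℝ f) y
    - (ContinuousLinearMap.compL ℝ (E n) (E n) ℝ (fderiv ℝ f y)).comp (connForm G y)

/-- The covariant derivative `c ↦ ∇_c X` of a vector field, whose trace is the divergence. -/
def covDeriv (G : E n → Matrix (Fin n) (Fin n) ℝ) (X : E n → E n) (y : E n) : E n →L[ℝ] E n :=
  fderiv ℝ X y + (connForm G y).flip (X y)

lemma metricForm_apply (u v : E n) : metricForm G y u v = ∑ i, ∑ j, G y i j * (u i * v j) := by
  simp [metricForm]

lemma star_dotProduct_mulVec_eq_metricForm (v : Fin n → ℝ) :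
    star v ⬝ᵥ (G y *ᵥ v) = metricForm G y (WithLp.toLp 2 v) (WithLp.toLp 2 v) := by
  simp only [metricForm_apply, dotProduct, Matrix.mulVec, Finset.mul_sum, Pi.star_apply,
    star_trivial]
  exact Finset.sum_congr rfl fun i _ => Finset.sum_congr rfl fun j _ => by ring

@[simp]
lemma metricForm_stdVec (i j : Fin n) : metricForm G y (stdVec i) (stdVec j) = G y i j := by
  simp [metricForm_apply]

lemma connForm_apply (u v : E n) (k : Fin n) :
    connForm G y u v k = ∑ i, ∑ j, christoffel G k i j y * (u i * v j) := by
  simp [connForm, Pi.single_apply, Finset.sum_apply]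

lemma connForm_stdVec_left (i : Fin n) (v : E n) (k : Fin n) :
    connForm G y (stdVec i) v k = ∑ j, christoffel G k i j y * v j := by
  rw [connForm_apply, Finset.sum_eq_single i (fun _ _ h => by simp [h]) (by simp)]
  simp

lemma connForm_stdVec (i j k : Fin n) :
    connForm G y (stdVec i) (stdVec j) k = christoffel G k i j y := by
  simp [connForm_stdVec_left]

lemma divg_eq_trace_covDeriv {X : E n → E n} (hX : DifferentiableAt ℝ X y) :
    divg G (fun i z => X z i) y = LinearMap.trace ℝ (E n) (covDeriv G X y) := by
  have hcoord : ∀ i, pd i (fun z => X z i) y = fderiv ℝ X y (stdVec i) i := fun i =>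
    congrArg (· (stdVec i))
      ((EuclideanSpace.proj i : E n →L[ℝ] ℝ).hasFDerivAt.comp y hX.hasFDerivAt).fderiv
  simp [divg, trace_eq_sum_stdVec, covDeriv, connForm_stdVec_left, hcoord, Finset.sum_add_distrib]

namespace IsMetricOn

lemma contDiffOn_metricForm (hG : IsMetricOn G U) : ContDiffOn ℝ ∞ (metricForm G) U :=
  ContDiffOn.sum fun i _ => ContDiffOn.sum fun j _ => contDiffOn_smul_const (hG.contDiffOn i j) _

lemma contDiffOn_connForm (hG : IsMetricOn G U) : ContDiffOn ℝ ∞ (connForm G) U :=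
  ContDiffOn.sum fun k _ => ContDiffOn.sum fun i _ => ContDiffOn.sum fun j _ =>
    contDiffOn_smul_const (hG.contDiffOn_christoffel k i j) _

lemma metricForm_comm (hG : IsMetricOn G U) (hy : y ∈ U) (u v : E n) :
    metricForm G y u v = metricForm G y v u := by
  rw [metricForm_apply, metricForm_apply, Finset.sum_comm]
  refine Finset.sum_congr rfl fun i _ => Finset.sum_congr rfl fun j _ => ?_
  rw [hG.entry_comm hy, mul_comm (u j)]

lemma metricForm_self_pos (hG : IsMetricOn G U) (hy : y ∈ U) {u : E n} (hu : u ≠ 0) :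
    0 < metricForm G y u u := by
  have hu' : (fun i => u i) ≠ 0 := fun h => hu (PiLp.ext fun i => congrFun h i)
  exact ((hG.posDef y hy).dotProduct_mulVec_pos hu').trans_eq
    (star_dotProduct_mulVec_eq_metricForm _)

lemma eq_of_metricForm_eq (hG : IsMetricOn G U) (hy : y ∈ U) {u v : E n}
    (h : ∀ w, metricForm G y u w = metricForm G y v w) : u = v := by
  by_contra hne
  refine (hG.metricForm_self_pos hy (sub_ne_zero.2 hne)).ne' ?_
  rw [map_sub (metricForm G y), sub_apply, h, sub_self]

lemma pd_entry (hG : IsMetricOn G U) (hy : y ∈ U) (i j k : Fin n) :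
    pd k (fun z => G z i j) y = fderiv ℝ (metricForm G) y (stdVec k) (stdVec i) (stdVec j) := by
  rw [← fderiv_apply₂_const (hG.differentiableAt hG.contDiffOn_metricForm hy)]
  simp [pd]

lemma pd_christoffel (hG : IsMetricOn G U) (hy : y ∈ U) (i j k l : Fin n) :
    pd l (christoffel G k i j) y =
      fderiv ℝ (connForm G) y (stdVec l) (stdVec i) (stdVec j) k := by
  have hd := hG.differentiableAt hG.contDiffOn_connForm hy
  have hcoord : christoffel G k i j =
      (EuclideanSpace.proj k : E n →L[ℝ] ℝ) ∘ fun z => connForm G z (stdVec i) (stdVec j) := by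
    ext z; simp [connForm_stdVec]
  rw [← fderiv_apply₂_const hd, pd, hcoord, fderiv_comp y (by fun_prop) (by fun_prop),
    ContinuousLinearMap.fderiv]
  rfl

lemma two_mul_sum_entry_mul_christoffel (hG : IsMetricOn G U) (hy : y ∈ U) (i j l : Fin n) :
    2 * ∑ k, G y l k * christoffel G k i j y =
      pd i (fun z => G z j l) y + pd j (fun z => G z i l) y - pd l (fun z => G z i j) y := by
  set K : Fin n → ℝ := fun m =>
    pd i (fun z => G z j m) y + pd j (fun z => G z i m) y - pd m (fun z => G z i j) y with hK
  have hlower : (G y *ᵥ ((G y)⁻¹ *ᵥ K)) l = K l := by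
    rw [Matrix.mulVec_mulVec, Matrix.mul_nonsing_inv _ (hG.isUnit_det hy), Matrix.one_mulVec]
  refine Eq.trans ?_ hlower
  simp only [christoffel, Matrix.mulVec, dotProduct, Finset.mul_sum, hK]
  exact Finset.sum_congr rfl fun a _ => Finset.sum_congr rfl fun b _ => by ring

lemma koszul (hG : IsMetricOn G U) (hy : y ∈ U) (u v w : E n) :
    2 * metricForm G y (connForm G y u v) w =
      fderiv ℝ (metricForm G) y u v w + fderiv ℝ (metricForm G) y v u w
        - fderiv ℝ (metricForm G) y w u v := by
  set g := metricForm G y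
  set Γ := connForm G y
  set Dg := fderiv ℝ (metricForm G) y
  refine sub_eq_zero.1 (eq_zero_of_apply_stdVec
    (L := fun u => 2 * g (Γ u v) w - (Dg u v w + Dg v u w - Dg w u v))
    ⟨by intros; simp; ring, by intros; simp; ring⟩ (fun i => ?_) u)
  refine eq_zero_of_apply_stdVec
    (L := fun v => 2 * g (Γ (stdVec i) v) w
      - (Dg (stdVec i) v w + Dg v (stdVec i) w - Dg w (stdVec i) v))
    ⟨by intros; simp; ring, by intros; simp; ring⟩ (fun j => ?_) v
  refine eq_zero_of_apply_stdVec
    (L := fun w => 2 * g (Γ (stdVec i) (stdVec j)) w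
      - (Dg (stdVec i) (stdVec j) w + Dg (stdVec j) (stdVec i) w - Dg w (stdVec i) (stdVec j)))
    ⟨by intros; simp; ring, by intros; simp; ring⟩ (fun l => ?_) w
  have hlower : g (stdVec l) (Γ (stdVec i) (stdVec j)) = ∑ k, G y l k * christoffel G k i j y := by
    rw [metricForm_apply, Finset.sum_eq_single l (fun _ _ h => by simp [h]) (by simp)]
    simp [Γ, connForm_stdVec]
  rw [hG.metricForm_comm hy, hlower, hG.two_mul_sum_entry_mul_christoffel hy, hG.pd_entry hy,
    hG.pd_entry hy, hG.pd_entry hy, sub_self]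

lemma fderiv_metricForm_comm (hG : IsMetricOn G U) (hy : y ∈ U) (u v w : E n) :
    fderiv ℝ (metricForm G) y u v w = fderiv ℝ (metricForm G) y u w v := by
  have hd := hG.differentiableAt hG.contDiffOn_metricForm hy
  rw [← fderiv_apply₂_const hd, ← fderiv_apply₂_const hd,
    eqOn_fderiv hG.isOpen (fun z hz => hG.metricForm_comm hz v w) hy]

lemma connForm_comm (hG : IsMetricOn G U) (hy : y ∈ U) (u v : E n) :
    connForm G y u v = connForm G y v u :=
  hG.eq_of_metricForm_eq hy fun w => by
    linarith [hG.koszul hy u v w, hG.koszul hy v u w, hG.fderiv_metricForm_comm hy w u v]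

lemma fderiv_metricForm (hG : IsMetricOn G U) (hy : y ∈ U) (u v w : E n) :
    fderiv ℝ (metricForm G) y u v w =
      metricForm G y (connForm G y u v) w + metricForm G y v (connForm G y u w) := by
  rw [hG.metricForm_comm hy v (connForm G y u w)]
  linarith [hG.koszul hy u v w, hG.koszul hy u w v, hG.fderiv_metricForm_comm hy u v w,
    hG.fderiv_metricForm_comm hy v u w, hG.fderiv_metricForm_comm hy w u v]

lemma ricciForm_stdVec (hG : IsMetricOn G U) (hy : y ∈ U) (i j : Fin n) :
    ricciForm G y (stdVec i) (stdVec j) = ricci G i j y := by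
  rw [ricci, ← Finset.sum_add_distrib, ricciForm, LinearMap.mk₂_apply, trace_eq_sum_stdVec]
  refine Finset.sum_congr rfl fun k _ => ?_
  simp only [curvEndo, ContinuousLinearMap.coe_coe, add_apply, sub_apply,
    ContinuousLinearMap.flip_apply, ContinuousLinearMap.comp_apply, PiLp.add_apply,
    PiLp.sub_apply, hG.pd_christoffel hy, connForm_stdVec_left, PiLp.single_apply,
    Finset.sum_sub_distrib]
  simp
  ring

lemma hessForm_stdVec (hG : IsMetricOn G U) (hf : ContDiffOn ℝ ∞ f U) (hy : y ∈ U)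
    (i j : Fin n) : hessForm G f y (stdVec i) (stdVec j) = hess G f i j y := by
  have hconn : ∑ k, christoffel G k i j y * pd k f y =
      fderiv ℝ f y (connForm G y (stdVec i) (stdVec j)) := by
    rw [← sum_smul_stdVec (connForm G y (stdVec i) (stdVec j)), map_sum]
    simp [connForm_stdVec, pd]
  rw [hess, pd_pd_eq_fderiv_fderiv hG.isOpen hf hy, hconn]
  rfl

end IsMetricOn

end Tensors

/-! ### Invariance under changes of coordinates -/

section JacobianMatrix

variable {n : ℕ} {G : E n → Matrix (Fin n) (Fin n) ℝ} {Φ : E n → E n} {y : E n}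

/-- The Jacobian matrix `∂_i Φ^k` of `Φ`, with row index `k`. -/
def jac (Φ : E n → E n) (y : E n) : Matrix (Fin n) (Fin n) ℝ :=
  Matrix.of fun k i => fderiv ℝ Φ y (stdVec i) k

lemma jac_mulVec (w : E n) (k : Fin n) : (jac Φ y *ᵥ fun i => w i) k = fderiv ℝ Φ y w k := by
  conv_rhs => rw [← sum_smul_stdVec w, map_sum]
  simp [jac, Matrix.mulVec, dotProduct, mul_comm]

lemma of_bilinear_fderiv (B : E n →ₗ[ℝ] E n →ₗ[ℝ] ℝ) :
    Matrix.of (fun i j => B (fderiv ℝ Φ y (stdVec i)) (fderiv ℝ Φ y (stdVec j))) =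
      (jac Φ y)ᵀ * Matrix.of (fun k l => B (stdVec k) (stdVec l)) * jac Φ y := by
  ext i j
  rw [Matrix.of_apply, bilinear_apply_eq_sum, Finset.sum_comm]
  simp only [Matrix.mul_apply, Matrix.transpose_apply, Matrix.of_apply, Finset.sum_mul, jac]
  exact Finset.sum_congr rfl fun l _ => Finset.sum_congr rfl fun k _ => by ring

lemma contract_eq_trace (S T : Fin n → Fin n → ℝ) (y : E n) :
    contract G S T y = (Matrix.of S * (G y)⁻¹ * (Matrix.of T)ᵀ * ((G y)⁻¹)ᵀ).trace := by
  simp only [contract, Matrix.trace, Matrix.diag, Matrix.mul_apply, Matrix.transpose_apply,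
    Matrix.of_apply, Finset.sum_mul]
  refine Finset.sum_congr rfl fun i _ => ?_
  rw [Finset.sum_comm]
  refine Finset.sum_congr rfl fun k _ => ?_
  rw [Finset.sum_comm]
  exact Finset.sum_congr rfl fun l _ => Finset.sum_congr rfl fun j _ => by ring

lemma sum_inv_mul_eq_trace (S : Fin n → Fin n → ℝ) (y : E n) :
    ∑ i, ∑ j, (G y)⁻¹ i j * S i j = (Matrix.of S * ((G y)⁻¹)ᵀ).trace := by
  simp only [Matrix.trace, Matrix.diag, Matrix.mul_apply, Matrix.transpose_apply,
    Matrix.of_apply, mul_comm]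

lemma sum_inv_mul_mul_eq_mulVec (S : Fin n → Fin n → ℝ) (v : Fin n → ℝ) (y : E n) :
    (fun i => ∑ j, ∑ k, (G y)⁻¹ i j * S j k * v k) = (G y)⁻¹ *ᵥ (Matrix.of S *ᵥ v) := by
  ext i
  simp only [Matrix.mulVec, dotProduct, Finset.mul_sum, mul_assoc, Matrix.of_apply]

end JacobianMatrix

section Pullback

variable {n : ℕ} {U V : Set (E n)} {f f' : E n → ℝ} {G G' : E n → Matrix (Fin n) (Fin n) ℝ}
  {y : E n} {Φ : E n → E n}

/-- The metric `G'` on `V` is the pullback of the metric `G` on `U` by the smooth map `Φ`. No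
injectivity of `Φ` is required. -/
structure IsPullback (Φ : E n → E n) (G' : E n → Matrix (Fin n) (Fin n) ℝ) (V : Set (E n))
    (G : E n → Matrix (Fin n) (Fin n) ℝ) (U : Set (E n)) : Prop where
  source : IsMetricOn G' V
  target : IsMetricOn G U
  contDiffOn : ContDiffOn ℝ ∞ Φ V
  mapsTo : Set.MapsTo Φ V U
  entry : ∀ y ∈ V, ∀ i j,
    G' y i j = metricForm G (Φ y) (fderiv ℝ Φ y (stdVec i)) (fderiv ℝ Φ y (stdVec j))

namespace IsPullback

lemma matrix_eq (hP : IsPullback Φ G' V G U) (hy : y ∈ V) :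
    G' y = (jac Φ y)ᵀ * G (Φ y) * jac Φ y := by
  have h := of_bilinear_fderiv (Φ := Φ) (y := y) (metricForm G (Φ y)).toBilinForm
  simp only [ContinuousLinearMap.toBilinForm_apply, metricForm_stdVec, ← hP.entry y hy] at h
  exact h

lemma metricForm_eq (hP : IsPullback Φ G' V G U) (hy : y ∈ V) (a b : E n) :
    metricForm G' y a b = metricForm G (Φ y) (fderiv ℝ Φ y a) (fderiv ℝ Φ y b) := by
  have h := bilinear_apply_eq_sum ((metricForm G (Φ y)).toBilinForm.compl₁₂
    (fderiv ℝ Φ y : E n →ₗ[ℝ] E n) (fderiv ℝ Φ y : E n →ₗ[ℝ] E n)) a b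
  simp only [LinearMap.compl₁₂_apply, ContinuousLinearMap.toBilinForm_apply,
    ContinuousLinearMap.coe_coe, ← hP.entry y hy] at h
  rw [h, metricForm_apply]

lemma fderiv_injective (hP : IsPullback Φ G' V G U) (hy : y ∈ V) :
    Function.Injective (fderiv ℝ Φ y) := by
  refine (injective_iff_map_eq_zero _).2 fun a ha => ?_
  by_contra hne
  have := hP.source.metricForm_self_pos hy hne
  simp [hP.metricForm_eq hy, ha] at this

lemma fderiv_surjective (hP : IsPullback Φ G' V G U) (hy : y ∈ V) :
    Function.Surjective (fderiv ℝ Φ y) :=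
  (LinearMap.injective_iff_surjective (f := (fderiv ℝ Φ y : E n →ₗ[ℝ] E n))).1
    (hP.fderiv_injective hy)

section ChainRule

variable {Y : Type*} [NormedAddCommGroup Y] [NormedSpace ℝ Y]

lemma differentiableAt (hP : IsPullback Φ G' V G U) (hy : y ∈ V) : DifferentiableAt ℝ Φ y :=
  hP.source.differentiableAt hP.contDiffOn hy

lemma differentiableAt_fderiv (hP : IsPullback Φ G' V G U) (hy : y ∈ V) :
    DifferentiableAt ℝ (fderiv ℝ Φ) y :=
  hP.source.differentiableAt (contDiffOn_fderiv hP.source.isOpen hP.contDiffOn) hy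

lemma contDiffOn_comp (hP : IsPullback Φ G' V G U) {F : E n → Y} (hF : ContDiffOn ℝ ∞ F U) :
    ContDiffOn ℝ ∞ (fun z => F (Φ z)) V :=
  hF.comp hP.contDiffOn hP.mapsTo

lemma fderiv_comp (hP : IsPullback Φ G' V G U) (hy : y ∈ V) {F : E n → Y}
    (hF : ContDiffOn ℝ ∞ F U) (c : E n) :
    fderiv ℝ (fun z => F (Φ z)) y c = fderiv ℝ F (Φ y) (fderiv ℝ Φ y c) :=
  congrArg (· c) ((hP.target.differentiableAt hF (hP.mapsTo hy)).hasFDerivAt.comp y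
    (hP.differentiableAt hy).hasFDerivAt).fderiv

lemma differentiableAt_comp_apply₂ (hP : IsPullback Φ G' V G U) (hy : y ∈ V)
    {F : E n → E n →L[ℝ] E n →L[ℝ] Y} (hF : ContDiffOn ℝ ∞ F U) (a b : E n) :
    DifferentiableAt ℝ (fun z => F (Φ z) (fderiv ℝ Φ z a) (fderiv ℝ Φ z b)) y :=
  have hΦ := fun c => (hP.differentiableAt_fderiv hy).clm_apply (differentiableAt_const c)
  ((hP.source.differentiableAt (hP.contDiffOn_comp hF) hy).clm_apply (hΦ a)).clm_apply (hΦ b)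

lemma fderiv_comp_apply₂ (hP : IsPullback Φ G' V G U) (hy : y ∈ V)
    {F : E n → E n →L[ℝ] E n →L[ℝ] Y} (hF : ContDiffOn ℝ ∞ F U) (a b c : E n) :
    fderiv ℝ (fun z => F (Φ z) (fderiv ℝ Φ z a) (fderiv ℝ Φ z b)) y c =
      fderiv ℝ F (Φ y) (fderiv ℝ Φ y c) (fderiv ℝ Φ y a) (fderiv ℝ Φ y b)
        + F (Φ y) (fderiv ℝ (fderiv ℝ Φ) y c a) (fderiv ℝ Φ y b)
        + F (Φ y) (fderiv ℝ Φ y a) (fderiv ℝ (fderiv ℝ Φ) y c b) := by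
  have hΦ := hP.differentiableAt_fderiv hy
  rw [fderiv_apply₂ (hP.source.differentiableAt (hP.contDiffOn_comp hF) hy)
    (hΦ.clm_apply (differentiableAt_const a)) (hΦ.clm_apply (differentiableAt_const b)),
    hP.fderiv_comp hy hF, fderiv_apply_const hΦ, fderiv_apply_const hΦ]

end ChainRule

lemma fderiv_metricForm_eq (hP : IsPullback Φ G' V G U) (hy : y ∈ V) (a b c : E n) :
    fderiv ℝ (metricForm G') y c a b =
      fderiv ℝ (metricForm G) (Φ y) (fderiv ℝ Φ y c) (fderiv ℝ Φ y a) (fderiv ℝ Φ y b)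
        + metricForm G (Φ y) (fderiv ℝ (fderiv ℝ Φ) y c a) (fderiv ℝ Φ y b)
        + metricForm G (Φ y) (fderiv ℝ Φ y a) (fderiv ℝ (fderiv ℝ Φ) y c b) := by
  rw [← fderiv_apply₂_const (hP.source.differentiableAt hP.source.contDiffOn_metricForm hy),
    eqOn_fderiv hP.source.isOpen (fun z hz => hP.metricForm_eq hz a b) hy,
    hP.fderiv_comp_apply₂ hy hP.target.contDiffOn_metricForm]

lemma connForm_eq (hP : IsPullback Φ G' V G U) (hy : y ∈ V) (a b : E n) :
    fderiv ℝ Φ y (connForm G' y a b) = fderiv ℝ (fderiv ℝ Φ) y a b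
      + connForm G (Φ y) (fderiv ℝ Φ y a) (fderiv ℝ Φ y b) := by
  refine hP.target.eq_of_metricForm_eq (hP.mapsTo hy) fun w => ?_
  obtain ⟨c, rfl⟩ := hP.fderiv_surjective hy w
  have hsource := hP.source.koszul hy a b c
  have htarget := hP.target.koszul (hP.mapsTo hy)
    (fderiv ℝ Φ y a) (fderiv ℝ Φ y b) (fderiv ℝ Φ y c)
  have hcomm := hP.target.metricForm_comm (hP.mapsTo hy)
  have hD2 := fderiv_fderiv_comm hP.source.isOpen hP.contDiffOn hy
  rw [hP.metricForm_eq hy, hP.fderiv_metricForm_eq hy, hP.fderiv_metricForm_eq hy,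
    hP.fderiv_metricForm_eq hy, hD2 b a, hD2 c a, hD2 c b,
    hcomm (fderiv ℝ Φ y a) (fderiv ℝ (fderiv ℝ Φ) y b c),
    hcomm (fderiv ℝ Φ y b) (fderiv ℝ (fderiv ℝ Φ) y a c)] at hsource
  rw [map_add, add_apply]
  linarith

lemma fderiv_connForm_eq (hP : IsPullback Φ G' V G U) (hy : y ∈ V) (a b c : E n) :
    fderiv ℝ Φ y (fderiv ℝ (connForm G') y c a b) =
      fderiv ℝ (fderiv ℝ (fderiv ℝ Φ)) y c a b
        + fderiv ℝ (connForm G) (Φ y) (fderiv ℝ Φ y c) (fderiv ℝ Φ y a) (fderiv ℝ Φ y b)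
        + connForm G (Φ y) (fderiv ℝ (fderiv ℝ Φ) y c a) (fderiv ℝ Φ y b)
        + connForm G (Φ y) (fderiv ℝ Φ y a) (fderiv ℝ (fderiv ℝ Φ) y c b)
        - fderiv ℝ (fderiv ℝ Φ) y c (connForm G' y a b) := by
  have hV := hP.source.isOpen
  have hconn := hP.source.differentiableAt hP.source.contDiffOn_connForm hy
  have hD2 := hP.source.differentiableAt
    (contDiffOn_fderiv hV (contDiffOn_fderiv hV hP.contDiffOn)) hy
  have hleft : fderiv ℝ (fun z => fderiv ℝ Φ z (connForm G' z a b)) y c =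
      fderiv ℝ (fderiv ℝ Φ) y c (connForm G' y a b)
        + fderiv ℝ Φ y (fderiv ℝ (connForm G') y c a b) := by
    rw [fderiv_clm_apply (hP.differentiableAt_fderiv hy) (by fun_prop)]
    simp [fderiv_apply₂_const hconn, add_comm]
  rw [eq_sub_iff_add_eq', ← hleft,
    eqOn_fderiv hV (fun z hz => hP.connForm_eq hz a b) hy,
    fderiv_fun_add (by fun_prop) (hP.differentiableAt_comp_apply₂ hy
      hP.target.contDiffOn_connForm a b), add_apply, fderiv_apply₂_const hD2,
    hP.fderiv_comp_apply₂ hy hP.target.contDiffOn_connForm]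
  abel

lemma curvEndo_eq (hP : IsPullback Φ G' V G U) (hy : y ∈ V) (a b c : E n) :
    fderiv ℝ Φ y (curvEndo G' y a b c) =
      curvEndo G (Φ y) (fderiv ℝ Φ y a) (fderiv ℝ Φ y b) (fderiv ℝ Φ y c) := by
  have hD2 := fderiv_fderiv_comm hP.source.isOpen hP.contDiffOn hy
  have hD3 := fderiv_fderiv_fderiv_comm hP.source.isOpen hP.contDiffOn hy
  have hcomm := hP.target.connForm_comm (hP.mapsTo hy)
  simp only [curvEndo, add_apply, sub_apply, ContinuousLinearMap.flip_apply,
    ContinuousLinearMap.comp_apply, map_add, map_sub, hP.connForm_eq hy,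
    hP.fderiv_connForm_eq hy]
  rw [hD3 c b a, hD2 c b, hD2 c a, hD2 a b, hcomm (fderiv ℝ (fderiv ℝ Φ) y b c),
    hcomm (fderiv ℝ (fderiv ℝ Φ) y b a)]
  abel

lemma ricciForm_eq (hP : IsPullback Φ G' V G U) (hy : y ∈ V) (a b : E n) :
    ricciForm G' y a b = ricciForm G (Φ y) (fderiv ℝ Φ y a) (fderiv ℝ Φ y b) :=
  trace_eq_of_intertwining (T := (fderiv ℝ Φ y : E n →ₗ[ℝ] E n)) (hP.fderiv_injective hy)
    (hP.curvEndo_eq hy b a)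

lemma ricci_eq (hP : IsPullback Φ G' V G U) (hy : y ∈ V) :
    Matrix.of (fun i j => ricci G' i j y) =
      (jac Φ y)ᵀ * Matrix.of (fun i j => ricci G i j (Φ y)) * jac Φ y := by
  simp only [← hP.source.ricciForm_stdVec hy, ← hP.target.ricciForm_stdVec (hP.mapsTo hy),
    hP.ricciForm_eq hy, of_bilinear_fderiv]

lemma fderiv_eq (hP : IsPullback Φ G' V G U) (hf : ContDiffOn ℝ ∞ f U)
    (hff : Set.EqOn f' (fun z => f (Φ z)) V) (hy : y ∈ V) (c : E n) :
    fderiv ℝ f' y c = fderiv ℝ f (Φ y) (fderiv ℝ Φ y c) := by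
  rw [eqOn_fderiv hP.source.isOpen hff hy, hP.fderiv_comp hy hf]

lemma hessForm_eq (hP : IsPullback Φ G' V G U) (hf : ContDiffOn ℝ ∞ f U)
    (hff : Set.EqOn f' (fun z => f (Φ z)) V) (hy : y ∈ V) (a b : E n) :
    hessForm G' f' y a b = hessForm G f (Φ y) (fderiv ℝ Φ y a) (fderiv ℝ Φ y b) := by
  have hV := hP.source.isOpen
  have hf' : ContDiffOn ℝ ∞ f' V := (hP.contDiffOn_comp hf).congr hff
  have hDf := contDiffOn_fderiv hP.target.isOpen hf
  have hsecond : fderiv ℝ (fderiv ℝ f') y a b =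
      fderiv ℝ (fderiv ℝ f) (Φ y) (fderiv ℝ Φ y a) (fderiv ℝ Φ y b)
        + fderiv ℝ f (Φ y) (fderiv ℝ (fderiv ℝ Φ) y a b) := by
    rw [← fderiv_apply_const (hP.source.differentiableAt (contDiffOn_fderiv hV hf') hy),
      eqOn_fderiv hV (fun z hz => hP.fderiv_eq hf hff hz b) hy,
      fderiv_clm_apply (hP.source.differentiableAt (hP.contDiffOn_comp hDf) hy)
        ((hP.differentiableAt_fderiv hy).clm_apply (differentiableAt_const b))]
    simp [hP.fderiv_comp hy hDf, fderiv_apply_const (hP.differentiableAt_fderiv hy), add_comm]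
  simp only [hessForm, sub_apply, ContinuousLinearMap.comp_apply,
    ContinuousLinearMap.compL_apply, hsecond, hP.fderiv_eq hf hff hy, hP.connForm_eq hy, map_add]
  ring

lemma hess_eq (hP : IsPullback Φ G' V G U) (hf : ContDiffOn ℝ ∞ f U)
    (hff : Set.EqOn f' (fun z => f (Φ z)) V) (hy : y ∈ V) :
    Matrix.of (fun i j => hess G' f' i j y) =
      (jac Φ y)ᵀ * Matrix.of (fun i j => hess G f i j (Φ y)) * jac Φ y := by
  have hf' : ContDiffOn ℝ ∞ f' V := (hP.contDiffOn_comp hf).congr hff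
  have h := of_bilinear_fderiv (Φ := Φ) (y := y) (hessForm G f (Φ y)).toBilinForm
  simp only [ContinuousLinearMap.toBilinForm_apply, hP.target.hessForm_stdVec hf (hP.mapsTo hy),
    ← hP.hessForm_eq hf hff hy, hP.source.hessForm_stdVec hf' hy] at h
  exact h

lemma covDeriv_eq (hP : IsPullback Φ G' V G U) (hy : y ∈ V) {X X' : E n → E n}
    (hX : ContDiffOn ℝ ∞ X U) (hX' : ContDiffOn ℝ ∞ X' V)
    (hXX : Set.EqOn (fun z => fderiv ℝ Φ z (X' z)) (fun z => X (Φ z)) V) (c : E n) :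
    fderiv ℝ Φ y (covDeriv G' X' y c) = covDeriv G X (Φ y) (fderiv ℝ Φ y c) := by
  have hderiv := congrArg (· c) (eqOn_fderiv hP.source.isOpen hXX hy)
  simp only [hP.fderiv_comp hy hX, fderiv_clm_apply (hP.differentiableAt_fderiv hy)
    (hP.source.differentiableAt hX' hy), add_apply, ContinuousLinearMap.comp_apply,
    ContinuousLinearMap.flip_apply] at hderiv
  simp only [covDeriv, add_apply, ContinuousLinearMap.flip_apply, map_add, hP.connForm_eq hy,
    ← hderiv]
  rw [show fderiv ℝ Φ y (X' y) = X (Φ y) from hXX hy]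
  abel

lemma divg_eq (hP : IsPullback Φ G' V G U) (hy : y ∈ V) {X X' : Fin n → E n → ℝ}
    (hX : ∀ i, ContDiffOn ℝ ∞ (X i) U) (hX' : ∀ i, ContDiffOn ℝ ∞ (X' i) V)
    (hXX : ∀ z ∈ V, jac Φ z *ᵥ (fun i => X' i z) = fun i => X i (Φ z)) :
    divg G' X' y = divg G X (Φ y) := by
  let W : E n → E n := fun z => WithLp.toLp 2 (X · z)
  let W' : E n → E n := fun z => WithLp.toLp 2 (X' · z)
  have hW : ContDiffOn ℝ ∞ W U := (contDiffOn_piLp 2).2 hX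
  have hW' : ContDiffOn ℝ ∞ W' V := (contDiffOn_piLp 2).2 hX'
  have hWW : Set.EqOn (fun z => fderiv ℝ Φ z (W' z)) (fun z => W (Φ z)) V := fun z hz =>
    PiLp.ext fun k => (jac_mulVec (W' z) k).symm.trans (congrFun (hXX z hz) k)
  have hdiv := divg_eq_trace_covDeriv (G := G) (hP.target.differentiableAt hW (hP.mapsTo hy))
  have hdiv' := divg_eq_trace_covDeriv (G := G') (hP.source.differentiableAt hW' hy)
  refine hdiv'.trans (Eq.trans ?_ hdiv.symm)
  exact trace_eq_of_intertwining (T := (fderiv ℝ Φ y : E n →ₗ[ℝ] E n)) (hP.fderiv_injective hy)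
    (hP.covDeriv_eq hy hW hW' hWW)

lemma isUnit_det_jac (hP : IsPullback Φ G' V G U) (hy : y ∈ V) : IsUnit (jac Φ y).det := by
  have h := (hP.source.det_pos hy).ne'
  rw [hP.matrix_eq hy, Matrix.det_mul] at h
  exact (right_ne_zero_of_mul h).isUnit

lemma jac_mul_inv_mul (hP : IsPullback Φ G' V G U) (hy : y ∈ V) :
    jac Φ y * ((G' y)⁻¹ * (jac Φ y)ᵀ) = (G (Φ y))⁻¹ := by
  have hu := hP.isUnit_det_jac hy
  have hut : IsUnit ((jac Φ y)ᵀ).det := by rwa [Matrix.det_transpose]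
  rw [hP.matrix_eq hy, Matrix.mul_inv_rev, Matrix.mul_inv_rev, Matrix.mul_assoc,
    Matrix.mul_assoc, Matrix.nonsing_inv_mul _ hut, Matrix.mul_one, ← Matrix.mul_assoc,
    Matrix.mul_nonsing_inv _ hu, Matrix.one_mul]

lemma jac_mul_inv_transpose_mul (hP : IsPullback Φ G' V G U) (hy : y ∈ V) :
    jac Φ y * (((G' y)⁻¹)ᵀ * (jac Φ y)ᵀ) = ((G (Φ y))⁻¹)ᵀ := by
  rw [← hP.jac_mul_inv_mul hy]
  simp [Matrix.transpose_mul, Matrix.mul_assoc]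

lemma contract_eq (hP : IsPullback Φ G' V G U) (hy : y ∈ V) {S T S' T' : Fin n → Fin n → ℝ}
    (hS : Matrix.of S' = (jac Φ y)ᵀ * Matrix.of S * jac Φ y)
    (hT : Matrix.of T' = (jac Φ y)ᵀ * Matrix.of T * jac Φ y) :
    contract G' S' T' y = contract G S T (Φ y) := by
  rw [contract_eq_trace, contract_eq_trace, hS, hT, ← hP.jac_mul_inv_transpose_mul hy,
    ← hP.jac_mul_inv_mul hy]
  simp only [Matrix.transpose_mul, Matrix.transpose_transpose, Matrix.mul_assoc]
  rw [Matrix.trace_mul_comm]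
  simp only [Matrix.mul_assoc]

lemma trace_eq (hP : IsPullback Φ G' V G U) (hy : y ∈ V) {S S' : Fin n → Fin n → ℝ}
    (hS : Matrix.of S' = (jac Φ y)ᵀ * Matrix.of S * jac Φ y) :
    ∑ i, ∑ j, (G' y)⁻¹ i j * S' i j = ∑ i, ∑ j, (G (Φ y))⁻¹ i j * S i j := by
  rw [sum_inv_mul_eq_trace, sum_inv_mul_eq_trace, hS, ← hP.jac_mul_inv_transpose_mul hy,
    Matrix.mul_assoc, Matrix.mul_assoc, Matrix.trace_mul_comm]
  simp only [Matrix.mul_assoc]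

lemma pd_eq (hP : IsPullback Φ G' V G U) (hf : ContDiffOn ℝ ∞ f U)
    (hff : Set.EqOn f' (fun z => f (Φ z)) V) (hy : y ∈ V) :
    (fun i => pd i f' y) = (jac Φ y)ᵀ *ᵥ (fun i => pd i f (Φ y)) := by
  ext i
  rw [pd, hP.fderiv_eq hf hff hy]
  conv_lhs => rw [← sum_smul_stdVec (fderiv ℝ Φ y _), map_sum]
  simp [Matrix.mulVec, dotProduct, jac, pd]

lemma grad_eq (hP : IsPullback Φ G' V G U) (hf : ContDiffOn ℝ ∞ f U)
    (hff : Set.EqOn f' (fun z => f (Φ z)) V) (hy : y ∈ V) :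
    jac Φ y *ᵥ (fun i => grad G' f' i y) = fun i => grad G f i (Φ y) := by
  change jac Φ y *ᵥ ((G' y)⁻¹ *ᵥ fun j => pd j f' y) = (G (Φ y))⁻¹ *ᵥ fun j => pd j f (Φ y)
  rw [hP.pd_eq hf hff hy, Matrix.mulVec_mulVec, Matrix.mulVec_mulVec, Matrix.mul_assoc,
    hP.jac_mul_inv_mul hy]

lemma raise_eq (hP : IsPullback Φ G' V G U) (hy : y ∈ V) {S S' : Fin n → Fin n → ℝ}
    (hS : Matrix.of S' = (jac Φ y)ᵀ * Matrix.of S * jac Φ y) {v v' : Fin n → ℝ}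
    (hv : jac Φ y *ᵥ v' = v) :
    jac Φ y *ᵥ (fun i => ∑ j, ∑ k, (G' y)⁻¹ i j * S' j k * v' k) =
      fun i => ∑ j, ∑ k, (G (Φ y))⁻¹ i j * S j k * v k := by
  rw [sum_inv_mul_mul_eq_mulVec, sum_inv_mul_mul_eq_mulVec, hS, ← hv, ← hP.jac_mul_inv_mul hy]
  simp only [Matrix.mulVec_mulVec, Matrix.mul_assoc]

lemma sum_pd_mul_eq (hP : IsPullback Φ G' V G U) (hf : ContDiffOn ℝ ∞ f U)
    (hff : Set.EqOn f' (fun z => f (Φ z)) V) (hy : y ∈ V) {v v' : Fin n → ℝ}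
    (hv : jac Φ y *ᵥ v' = v) :
    ∑ i, pd i f' y * v' i = ∑ i, pd i f (Φ y) * v i := by
  change (fun i => pd i f' y) ⬝ᵥ v' = (fun i => pd i f (Φ y)) ⬝ᵥ v
  rw [hP.pd_eq hf hff hy, ← hv, Matrix.mulVec_transpose, Matrix.dotProduct_mulVec]

lemma lap_eq (hP : IsPullback Φ G' V G U) (hf : ContDiffOn ℝ ∞ f U)
    (hff : Set.EqOn f' (fun z => f (Φ z)) V) (hy : y ∈ V) : lap G' f' y = lap G f (Φ y) :=
  hP.trace_eq hy (hP.hess_eq hf hff hy)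

lemma locJ_eq (hP : IsPullback Φ G' V G U) (hy : y ∈ V) : locJ G' y = locJ G (Φ y) := by
  rw [locJ, locJ, scalarCurv, hP.trace_eq hy (hP.ricci_eq hy), scalarCurv]

lemma schouten_eq (hP : IsPullback Φ G' V G U) (hy : y ∈ V) :
    Matrix.of (fun i j => schouten G' i j y) =
      (jac Φ y)ᵀ * Matrix.of (fun i j => schouten G i j (Φ y)) * jac Φ y := by
  have hmatrix : ∀ (G : E n → Matrix (Fin n) (Fin n) ℝ) (y : E n),
      Matrix.of (fun i j => schouten G i j y) = (1 / ((n : ℝ) - 2)) •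
        (Matrix.of (fun i j => ricci G i j y) - locJ G y • G y) := fun _ _ => rfl
  rw [hmatrix, hmatrix, hP.ricci_eq hy, hP.locJ_eq hy]
  conv_lhs => rw [hP.matrix_eq hy]
  simp only [Matrix.mul_smul, Matrix.smul_mul, Matrix.mul_sub, Matrix.sub_mul]

lemma locSigmaTwo_eq (hP : IsPullback Φ G' V G U) (hy : y ∈ V) :
    locSigmaTwo G' y = locSigmaTwo G (Φ y) := by
  rw [locSigmaTwo, locSigmaTwo, hP.locJ_eq hy,
    hP.contract_eq hy (hP.schouten_eq hy) (hP.schouten_eq hy)]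

lemma locQ_eq (hP : IsPullback Φ G' V G U) (hy : y ∈ V) : locQ G' y = locQ G (Φ y) := by
  rw [locQ, locQ, hP.locJ_eq hy, hP.contract_eq hy (hP.schouten_eq hy) (hP.schouten_eq hy),
    hP.lap_eq hP.target.contDiffOn_locJ (fun _ hz => hP.locJ_eq hz) hy]

lemma schoutenGrad_eq (hP : IsPullback Φ G' V G U) (hf : ContDiffOn ℝ ∞ f U)
    (hff : Set.EqOn f' (fun z => f (Φ z)) V) (hy : y ∈ V) :
    jac Φ y *ᵥ (fun i => schoutenGrad G' f' i y) = fun i => schoutenGrad G f i (Φ y) :=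
  hP.raise_eq hy (hP.schouten_eq hy) (hP.grad_eq hf hff hy)

lemma locP_eq (hP : IsPullback Φ G' V G U) (hf : ContDiffOn ℝ ∞ f U)
    (hff : Set.EqOn f' (fun z => f (Φ z)) V) (hy : y ∈ V) : locP G' f' y = locP G f (Φ y) := by
  have hf' : ContDiffOn ℝ ∞ f' V := (hP.contDiffOn_comp hf).congr hff
  rw [locP, locP, hff hy, hP.locQ_eq hy,
    hP.lap_eq (hP.target.contDiffOn_lap hf) (fun z hz => hP.lap_eq hf hff hz) hy,
    hP.divg_eq hy (hP.target.contDiffOn_paneitzField hf)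
      (hP.source.contDiffOn_paneitzField hf') fun z hz => ?_]
  have hsplit : (fun i => 4 * schoutenGrad G' f' i z
      - ((n : ℝ) - 2) * locJ G' z * grad G' f' i z) =
        (4 : ℝ) • (fun i => schoutenGrad G' f' i z)
          - (((n : ℝ) - 2) * locJ G' z) • (fun i => grad G' f' i z) := rfl
  rw [hsplit, Matrix.mulVec_sub, Matrix.mulVec_smul, Matrix.mulVec_smul,
    hP.schoutenGrad_eq hf hff hz, hP.grad_eq hf hff hz, hP.locJ_eq hz]
  rfl

lemma locH_eq (hP : IsPullback Φ G' V G U) (hf : ContDiffOn ℝ ∞ f U)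
    (hff : Set.EqOn f' (fun z => f (Φ z)) V) (hy : y ∈ V) (lam : ℝ) :
    locH G' lam f' y = locH G lam f (Φ y) := by
  rw [locH, locH, hP.locP_eq hf hff hy, hP.locQ_eq hy, hff hy, hP.locJ_eq hy,
    hP.lap_eq hf hff hy, hP.contract_eq hy (hP.schouten_eq hy) (hP.hess_eq hf hff hy),
    hP.locSigmaTwo_eq hy]

end IsPullback

end Pullback

/-! ### Bianchi and Bochner identities in normal coordinates -/

section NormalCoordinates

variable {n : ℕ} {U : Set (E n)} {f h : E n → ℝ} {G : E n → Matrix (Fin n) (Fin n) ℝ} {p : E n}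

/-- The vector field `D²f(∇h)`, with components `g^{ij} (D²f)_{jk} (∇h)^k`. -/
def hessGrad (G : E n → Matrix (Fin n) (Fin n) ℝ) (f h : E n → ℝ) (i : Fin n) (y : E n) : ℝ :=
  ∑ j, ∑ k, (G y)⁻¹ i j * hess G f j k y * grad G h k y

lemma IsMetricOn.contDiffOn_hessGrad (hG : IsMetricOn G U) (hf : ContDiffOn ℝ ∞ f U)
    (hh : ContDiffOn ℝ ∞ h U) (i : Fin n) : ContDiffOn ℝ ∞ (hessGrad G f h i) U :=
  ContDiffOn.sum fun j _ => ContDiffOn.sum fun k _ =>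
    ((hG.contDiffOn_inv i j).mul (hG.contDiffOn_hess hf j k)).mul (hG.contDiffOn_grad hh k)

/-- The coordinates are normal at `p` for the metric with matrix `G`, in the weak sense that `G`
agrees with the Euclidean metric to first order at `p`. -/
structure IsNormalAt (G : E n → Matrix (Fin n) (Fin n) ℝ) (U : Set (E n)) (p : E n) : Prop where
  metric : IsMetricOn G U
  mem : p ∈ U
  eq_one : G p = 1
  pd_entry : ∀ i j k, pd k (fun z => G z i j) p = 0

namespace IsNormalAt

lemma differentiableAt (hN : IsNormalAt G U p) {F : E n → ℝ} (hF : ContDiffOn ℝ ∞ F U) :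
    DifferentiableAt ℝ F p :=
  hN.metric.differentiableAt hF hN.mem

lemma inv_apply (hN : IsNormalAt G U p) (i j : Fin n) :
    (G p)⁻¹ i j = if i = j then 1 else 0 := by
  rw [hN.eq_one, inv_one, Matrix.one_apply]

lemma sum_inv_mul (hN : IsNormalAt G U p) (a : Fin n → ℝ) (k : Fin n) :
    ∑ l, (G p)⁻¹ k l * a l = a k := by
  simp [hN.inv_apply]

lemma pd_inv (hN : IsNormalAt G U p) (i j k : Fin n) :
    pd k (fun z => (G z)⁻¹ i j) p = 0 := by
  have hinv := fun l => hN.differentiableAt (hN.metric.contDiffOn_inv i l)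
  have hent := fun l => hN.differentiableAt (hN.metric.contDiffOn l j)
  have inv_mul_self : Set.EqOn (fun z => ∑ l, (G z)⁻¹ i l * G z l j)
      (fun _ => (1 : Matrix (Fin n) (Fin n) ℝ) i j) U := fun z hz => by
    simp only [← Matrix.mul_apply, Matrix.nonsing_inv_mul (G z) (hN.metric.isUnit_det hz)]
  have key := eqOn_pd hN.metric.isOpen inv_mul_self k hN.mem
  rw [pd_const, pd_sum fun l _ => (hinv l).fun_mul (hent l)] at key
  simpa [fun l => pd_mul (hinv l) (hent l) k, hN.pd_entry, hN.eq_one, Matrix.one_apply] using key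

lemma pd_sum_inv_mul (hN : IsNormalAt G U p) {a : Fin n → E n → ℝ}
    (ha : ∀ l, DifferentiableAt ℝ (a l) p) (k m : Fin n) :
    pd m (fun z => ∑ l, (G z)⁻¹ k l * a l z) p = pd m (a k) p := by
  have hinv := fun l => hN.differentiableAt (hN.metric.contDiffOn_inv k l)
  rw [pd_sum fun l _ => (hinv l).fun_mul (ha l)]
  simp only [fun l => pd_mul (hinv l) (ha l) m, hN.pd_inv, zero_mul, zero_add]
  exact hN.sum_inv_mul _ k

lemma pd_pd_sum_inv_mul (hN : IsNormalAt G U p) {a : Fin n → E n → ℝ}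
    (ha : ∀ l, ContDiffOn ℝ ∞ (a l) U) (ha0 : ∀ l, a l p = 0) (k m r : Fin n) :
    pd m (pd r (fun z => ∑ l, (G z)⁻¹ k l * a l z)) p = pd m (pd r (a k)) p := by
  have hU := hN.metric.isOpen
  have hinv := hN.metric.contDiffOn_inv k
  have hinv' := fun l => contDiffOn_pd hU (hinv l) r
  have ha' := fun l => contDiffOn_pd hU (ha l) r
  have leibniz : Set.EqOn (pd r (fun z => ∑ l, (G z)⁻¹ k l * a l z))
      (fun z => ∑ l, pd r (fun z => (G z)⁻¹ k l) z * a l z + ∑ l, (G z)⁻¹ k l * pd r (a l) z)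
      U := by
    intro z hz
    have hinv_z := fun l => hN.metric.differentiableAt (hinv l) hz
    have ha_z := fun l => hN.metric.differentiableAt (ha l) hz
    rw [pd_sum fun l _ => (hinv_z l).fun_mul (ha_z l)]
    simp only [fun l => pd_mul (hinv_z l) (ha_z l) r, Finset.sum_add_distrib]
  have hprod := fun l => hN.differentiableAt ((hinv' l).mul (ha l))
  rw [eqOn_pd hU leibniz m hN.mem,
    pd_add (hN.differentiableAt (ContDiffOn.sum fun l _ => (hinv' l).mul (ha l)))
      (hN.differentiableAt (ContDiffOn.sum fun l _ => (hinv l).mul (ha' l))),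
    hN.pd_sum_inv_mul fun l => hN.differentiableAt (ha' l), pd_sum fun l _ => hprod l]
  simp [fun l => pd_mul (hN.differentiableAt (hinv' l)) (hN.differentiableAt (ha l)) m, hN.pd_inv,
    ha0]

lemma christoffel_eq_zero (hN : IsNormalAt G U p) (k i j : Fin n) :
    christoffel G k i j p = 0 := by
  simp [christoffel, hN.pd_entry]

lemma pd_christoffel (hN : IsNormalAt G U p) (m k i j : Fin n) :
    pd m (christoffel G k i j) p = (1 / 2) * (pd m (pd i fun z => G z j k) p
      + pd m (pd j fun z => G z i k) p - pd m (pd k fun z => G z i j) p) := by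
  have hp := hN.metric.contDiffOn_pd_entry
  have hd := fun a b c => hN.differentiableAt (hp a b c)
  have hs := hN.differentiableAt (ContDiffOn.sum (s := Finset.univ) fun l _ =>
    (hN.metric.contDiffOn_inv k l).mul (((hp i j l).add (hp j i l)).sub (hp l i j)))
  refine (pd_const_mul hs (1 / 2) m).trans ?_
  rw [hN.pd_sum_inv_mul fun l => ((hd i j l).fun_add (hd j i l)).fun_sub (hd l i j),
    pd_sub ((hd i j k).fun_add (hd j i k)) (hd k i j), pd_add (hd i j k) (hd j i k)]

lemma pd_pd_christoffel (hN : IsNormalAt G U p) (m r k i j : Fin n) :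
    pd m (pd r (christoffel G k i j)) p = (1 / 2) * (pd m (pd r (pd i fun z => G z j k)) p
      + pd m (pd r (pd j fun z => G z i k)) p - pd m (pd r (pd k fun z => G z i j)) p) := by
  have hU := hN.metric.isOpen
  have hp := hN.metric.contDiffOn_pd_entry
  have ha := fun l => ((hp i j l).add (hp j i l)).sub (hp l i j)
  have hs := ContDiffOn.sum (s := Finset.univ) fun l _ =>
    (hN.metric.contDiffOn_inv k l).mul (ha l)
  have pd_eq : Set.EqOn (pd r (christoffel G k i j)) (fun z => (1 / 2) * _) U := fun z hz =>
    pd_const_mul (hN.metric.differentiableAt hs hz) (1 / 2) r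
  have pd_term : Set.EqOn (pd r (fun z => pd i (fun z => G z j k) z + pd j (fun z => G z i k) z
      - pd k (fun z => G z i j) z)) (fun z => pd r (pd i fun z => G z j k) z
        + pd r (pd j fun z => G z i k) z - pd r (pd k fun z => G z i j) z) U := fun z hz => by
    have hd := fun a b c => hN.metric.differentiableAt (hp a b c) hz
    rw [pd_sub ((hd i j k).fun_add (hd j i k)) (hd k i j), pd_add (hd i j k) (hd j i k)]
  have hd := fun a b c => hN.differentiableAt (contDiffOn_pd hU (hp a b c) r)
  rw [eqOn_pd hU pd_eq m hN.mem, pd_const_mul (hN.differentiableAt (contDiffOn_pd hU hs r)),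
    hN.pd_pd_sum_inv_mul ha fun l => by simp [hN.pd_entry], eqOn_pd hU pd_term m hN.mem,
    pd_sub ((hd i j k).fun_add (hd j i k)) (hd k i j), pd_add (hd i j k) (hd j i k)]

lemma ricci_eq (hN : IsNormalAt G U p) (i j : Fin n) :
    ricci G i j p = ∑ k, (pd k (christoffel G k i j) p - pd j (christoffel G k i k) p) := by
  simp [ricci, hN.christoffel_eq_zero]

lemma pd_christoffel_mul_christoffel (hN : IsNormalAt G U p) (m k i j k' i' j' : Fin n) :
    pd m (fun z => christoffel G k i j z * christoffel G k' i' j' z) p = 0 := by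
  have hd := fun k i j => hN.differentiableAt (hN.metric.contDiffOn_christoffel k i j)
  rw [pd_mul (hd _ _ _) (hd _ _ _), hN.christoffel_eq_zero, hN.christoffel_eq_zero, mul_zero,
    zero_mul, add_zero]

lemma pd_ricci (hN : IsNormalAt G U p) (m i j : Fin n) :
    pd m (ricci G i j) p = ∑ k, (pd m (pd k (christoffel G k i j)) p
      - pd m (pd j (christoffel G k i k)) p) := by
  have hc := hN.metric.contDiffOn_christoffel
  have hlin := fun k => (hN.metric.contDiffOn_pd_christoffel k k i j).sub
    (hN.metric.contDiffOn_pd_christoffel j k i k)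
  have hquad := fun k l =>
    ((hc k k l).mul (hc l i j)).sub ((hc k j l).mul (hc l i k))
  have hquad' := fun k => ContDiffOn.sum (s := Finset.univ) fun l _ => hquad k l
  refine (pd_add (hN.differentiableAt (ContDiffOn.sum (s := Finset.univ) fun k _ => hlin k))
    (hN.differentiableAt (ContDiffOn.sum (s := Finset.univ) fun k _ => hquad' k)) m).trans ?_
  have pd_quad : ∀ k, pd m (fun z => ∑ l, (christoffel G k k l z * christoffel G l i j z -
      christoffel G k j l z * christoffel G l i k z)) p = 0 := fun k => by
    rw [pd_sum fun l _ => hN.differentiableAt (hquad k l)]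
    refine Finset.sum_eq_zero fun l _ => ?_
    rw [pd_sub (hN.differentiableAt ((hc _ _ _).mul (hc _ _ _)))
        (hN.differentiableAt ((hc _ _ _).mul (hc _ _ _))),
      hN.pd_christoffel_mul_christoffel, hN.pd_christoffel_mul_christoffel, sub_zero]
  rw [pd_sum fun k _ => hN.differentiableAt (hlin k),
    pd_sum fun k _ => hN.differentiableAt (hquad' k)]
  simp only [pd_quad, Finset.sum_const_zero, add_zero]
  have hd := fun m k i j => hN.differentiableAt (hN.metric.contDiffOn_pd_christoffel m k i j)
  exact Finset.sum_congr rfl fun k _ => pd_sub (hd k k i j) (hd j k i k) m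

lemma pd_trace (hN : IsNormalAt G U p) {S : Fin n → Fin n → E n → ℝ}
    (hS : ∀ i j, ContDiffOn ℝ ∞ (S i j) U) (m : Fin n) :
    pd m (fun y => ∑ i, ∑ j, (G y)⁻¹ i j * S i j y) p = ∑ i, pd m (S i i) p := by
  rw [pd_sum fun i _ => hN.differentiableAt
    (ContDiffOn.sum fun j _ => (hN.metric.contDiffOn_inv i j).mul (hS i j))]
  exact Finset.sum_congr rfl fun i _ =>
    hN.pd_sum_inv_mul (fun j => hN.differentiableAt (hS i j)) i m

lemma pd_scalarCurv (hN : IsNormalAt G U p) (m : Fin n) :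
    pd m (scalarCurv G) p = ∑ i, pd m (ricci G i i) p :=
  hN.pd_trace hN.metric.contDiffOn_ricci m

end IsNormalAt

-- With `T a b c i k = ∂_a ∂_b ∂_c g_{ik}` the two sides are `∇_j R` and `2 ∇^i Rc_{ij}`.
lemma contracted_bianchi_of_third_derivatives {ι : Type*} [Fintype ι] {T : ι → ι → ι → ι → ι → ℝ}
    (swap₁₂ : ∀ a b c i k, T a b c i k = T b a c i k)
    (swap₂₃ : ∀ a b c i k, T a b c i k = T a c b i k)
    (swap₄₅ : ∀ a b c i k, T a b c i k = T a b c k i) (j : ι) :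
    ∑ i, ∑ k, ((1 / 2) * (T j k i i k + T j k i i k - T j k k i i)
        - (1 / 2) * (T j i i k k + T j i k i k - T j i k i k)) =
      2 * ∑ i, ∑ k, ((1 / 2) * (T i k i j k + T i k j i k - T i k k i j)
        - (1 / 2) * (T i j i k k + T i j k i k - T i j k i k)) := by
  have relabel₁ : ∑ i, ∑ k, T i k i j k = ∑ i, ∑ k, T i k k i j := by
    rw [Finset.sum_comm]
    refine Finset.sum_congr rfl fun i _ => Finset.sum_congr rfl fun k _ => ?_
    rw [swap₁₂, swap₄₅]
  have relabel₂ : ∑ i, ∑ k, T j k k i i = ∑ i, ∑ k, T j i i k k := Finset.sum_comm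
  have cyclic : ∀ i k, T i k j i k = T j k i i k := fun i k => by rw [swap₂₃, swap₁₂, swap₂₃]
  have swap : ∀ i k, T i j i k k = T j i i k k := fun i k => swap₁₂ _ _ _ _ _
  simp only [cyclic, swap, mul_add, mul_sub, Finset.sum_add_distrib, Finset.sum_sub_distrib,
    ← Finset.mul_sum, relabel₁, relabel₂]
  ring

namespace IsNormalAt

lemma pd_pd_entry_comm (hN : IsNormalAt G U p) (a b i j : Fin n) :
    pd a (pd b fun z => G z i j) p = pd b (pd a fun z => G z i j) p :=
  eqOn_pd_comm hN.metric.isOpen (hN.metric.contDiffOn i j) a b hN.mem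

lemma pd_scalarCurv_eq_two_mul (hN : IsNormalAt G U p) (j : Fin n) :
    pd j (scalarCurv G) p = 2 * ∑ i, pd i (ricci G i j) p := by
  have hU := hN.metric.isOpen
  rw [hN.pd_scalarCurv]
  simp only [hN.pd_ricci, hN.pd_pd_christoffel]
  refine contracted_bianchi_of_third_derivatives
    (T := fun a b c i k => pd a (pd b (pd c fun z => G z i k)) p) ?_ ?_ ?_ j <;> intro a b c i k
  · exact eqOn_pd_comm hU (hN.metric.contDiffOn_pd_entry c i k) a b hN.mem
  · exact eqOn_pd hU (eqOn_pd_comm hU (hN.metric.contDiffOn i k) b c) a hN.mem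
  · exact eqOn_pd hU (eqOn_pd hU (fun y hy => hN.metric.pd_entry_comm hy i k c) b) a hN.mem

lemma divg_eq (hN : IsNormalAt G U p) (X : Fin n → E n → ℝ) :
    divg G X p = ∑ i, pd i (X i) p := by
  simp [divg, hN.christoffel_eq_zero]

lemma grad_eq (hN : IsNormalAt G U p) (h : E n → ℝ) (i : Fin n) : grad G h i p = pd i h p :=
  hN.sum_inv_mul _ i

lemma pd_grad (hN : IsNormalAt G U p) (hh : ContDiffOn ℝ ∞ h U) (i k : Fin n) :
    pd i (grad G h k) p = pd i (pd k h) p :=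
  hN.pd_sum_inv_mul (fun l => hN.differentiableAt (contDiffOn_pd hN.metric.isOpen hh l)) k i

lemma hess_eq (hN : IsNormalAt G U p) (h : E n → ℝ) (i k : Fin n) :
    hess G h i k p = pd i (pd k h) p := by
  simp [hess, hN.christoffel_eq_zero]

lemma lap_eq (hN : IsNormalAt G U p) (h : E n → ℝ) : lap G h p = ∑ i, pd i (pd i h) p := by
  simp only [lap, hN.sum_inv_mul, hN.hess_eq]

lemma contract_eq (hN : IsNormalAt G U p) (S T : Fin n → Fin n → ℝ) :
    contract G S T p = ∑ i, ∑ j, S i j * T i j := by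
  simp [contract, hN.inv_apply]

lemma pd_raise (hN : IsNormalAt G U p) {S : Fin n → Fin n → E n → ℝ} {v : Fin n → E n → ℝ}
    (hS : ∀ i j, ContDiffOn ℝ ∞ (S i j) U) (hv : ∀ i, ContDiffOn ℝ ∞ (v i) U) (m i : Fin n) :
    pd m (fun z => ∑ j, ∑ k, (G z)⁻¹ i j * S j k z * v k z) p =
      ∑ k, (pd m (S i k) p * v k p + S i k p * pd m (v k) p) := by
  have hd := fun j k => hN.differentiableAt ((hS j k).mul (hv k))
  simp only [mul_assoc, ← Finset.mul_sum]
  rw [hN.pd_sum_inv_mul fun j => DifferentiableAt.fun_sum fun k _ => hd j k,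
    pd_sum fun k _ => hd i k]
  exact Finset.sum_congr rfl fun k _ =>
    pd_mul (hN.differentiableAt (hS i k)) (hN.differentiableAt (hv k)) m

lemma divg_grad (hN : IsNormalAt G U p) (hh : ContDiffOn ℝ ∞ h U) :
    divg G (grad G h) p = lap G h p := by
  simp only [hN.divg_eq, hN.lap_eq, hN.pd_grad hh]

lemma pd_locJ (hN : IsNormalAt G U p) (j : Fin n) :
    pd j (locJ G) p = pd j (scalarCurv G) p / (2 * ((n : ℝ) - 1)) := by
  have hJ : locJ G = fun z => (2 * ((n : ℝ) - 1))⁻¹ * scalarCurv G z :=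
    funext fun z => div_eq_inv_mul _ _
  rw [hJ, pd_const_mul (hN.differentiableAt hN.metric.contDiffOn_scalarCurv), div_eq_inv_mul]

lemma pd_schouten (hN : IsNormalAt G U p) (m i j : Fin n) :
    pd m (schouten G i j) p = (1 / ((n : ℝ) - 2)) *
      (pd m (ricci G i j) p - if i = j then pd m (locJ G) p else 0) := by
  have hJ := hN.metric.contDiffOn_locJ
  have hR := hN.metric.contDiffOn_ricci i j
  have hE := hN.metric.contDiffOn i j
  refine (pd_const_mul (hN.differentiableAt (hR.sub (hJ.mul hE))) _ m).trans ?_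
  rw [pd_sub (hN.differentiableAt hR) (hN.differentiableAt (hJ.mul hE)),
    pd_mul (hN.differentiableAt hJ) (hN.differentiableAt hE), hN.pd_entry, hN.eq_one,
    Matrix.one_apply, mul_ite, mul_one, mul_zero, mul_zero, add_zero]

lemma sum_pd_schouten (hN : IsNormalAt G U p) (hn : 2 < n) (j : Fin n) :
    ∑ i, pd i (schouten G i j) p = pd j (locJ G) p := by
  have hn' : (2 : ℝ) < n := by exact_mod_cast hn
  have hn1 : (n : ℝ) - 1 ≠ 0 := by linarith
  have hn2 : (n : ℝ) - 2 ≠ 0 := by linarith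
  have bianchi : pd j (locJ G) p = 2 * (∑ i, pd i (ricci G i j) p) / (2 * ((n : ℝ) - 1)) := by
    rw [hN.pd_locJ, hN.pd_scalarCurv_eq_two_mul]
  simp only [hN.pd_schouten, ← Finset.mul_sum, Finset.sum_sub_distrib, Finset.sum_ite_eq',
    Finset.mem_univ, if_true, bianchi]
  field_simp
  ring

lemma divg_schoutenGrad (hN : IsNormalAt G U p) (hn : 2 < n) (hf : ContDiffOn ℝ ∞ f U) :
    divg G (schoutenGrad G f) p =
      contract G (fun i j => schouten G i j p) (fun i j => hess G f i j p) p
        + ∑ i, pd i (locJ G) p * grad G f i p := by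
  have leibniz : ∀ i, pd i (schoutenGrad G f i) p = _ := fun i =>
    hN.pd_raise hN.metric.contDiffOn_schouten (hN.metric.contDiffOn_grad hf) i i
  rw [hN.divg_eq, hN.contract_eq]
  simp only [leibniz, hN.grad_eq, hN.pd_grad hf, hN.hess_eq, Finset.sum_add_distrib,
    ← hN.sum_pd_schouten hn, Finset.sum_mul]
  rw [add_comm, Finset.sum_comm (f := fun i k => pd i (schouten G i k) p * pd k f p)]

lemma pd_hess (hN : IsNormalAt G U p) (hf : ContDiffOn ℝ ∞ f U) (m i j : Fin n) :
    pd m (hess G f i j) p = pd m (pd i (pd j f)) p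
      - ∑ l, pd m (christoffel G l i j) p * pd l f p := by
  have hU := hN.metric.isOpen
  have hc := fun l => hN.metric.contDiffOn_christoffel l i j
  have hp := fun l => contDiffOn_pd hU hf l
  have hd := fun l => hN.differentiableAt ((hc l).mul (hp l))
  refine (pd_sub (hN.differentiableAt (contDiffOn_pd hU (hp j) i))
    (DifferentiableAt.fun_sum fun l _ => hd l) m).trans ?_
  rw [pd_sum fun l _ => hd l]
  simp only [fun l => pd_mul (hN.differentiableAt (hc l)) (hN.differentiableAt (hp l)) m,
    hN.christoffel_eq_zero, zero_mul, add_zero]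

lemma pd_lap (hN : IsNormalAt G U p) (hf : ContDiffOn ℝ ∞ f U) (m : Fin n) :
    pd m (lap G f) p = ∑ i, pd m (hess G f i i) p :=
  hN.pd_trace (hN.metric.contDiffOn_hess hf) m

-- The curvature symmetry `R_{kiil} = R_{ilki}` in terms of `Γ`, which vanishes at `p`.
lemma pd_christoffel_sub_pd_christoffel (hN : IsNormalAt G U p) (k i l : Fin n) :
    pd k (christoffel G l i i) p - pd i (christoffel G l i k) p =
      pd i (christoffel G i k l) p - pd l (christoffel G i k i) p := by
  have entry_comm : ∀ a b i j, pd a (pd b fun z => G z i j) p = pd a (pd b fun z => G z j i) p :=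
    fun a b i j => eqOn_pd hN.metric.isOpen (fun z hz => hN.metric.pd_entry_comm hz i j b) a hN.mem
  simp only [hN.pd_christoffel]
  rw [hN.pd_pd_entry_comm k i i l, hN.pd_pd_entry_comm k l i i, entry_comm i k l i,
    entry_comm i l k i]
  ring

lemma sum_ricci_mul (hN : IsNormalAt G U p) (k : Fin n) (a : Fin n → ℝ) :
    ∑ l, ricci G k l p * a l = ∑ i, ∑ l,
      (pd k (christoffel G l i i) p * a l - pd i (christoffel G l i k) p * a l) := by
  simp only [hN.ricci_eq, ← hN.pd_christoffel_sub_pd_christoffel, ← sub_mul, Finset.sum_mul]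
  exact Finset.sum_comm

lemma sum_pd_hess (hN : IsNormalAt G U p) (hf : ContDiffOn ℝ ∞ f U) (k : Fin n) :
    ∑ i, pd i (hess G f i k) p = pd k (lap G f) p + ∑ l, ricci G k l p * pd l f p := by
  have hU := hN.metric.isOpen
  have third_comm : ∀ i, pd i (pd i (pd k f)) p = pd k (pd i (pd i f)) p := fun i => by
    rw [eqOn_pd hU (eqOn_pd_comm hU hf i k) i hN.mem,
      eqOn_pd_comm hU (contDiffOn_pd hU hf i) i k hN.mem]
  rw [hN.pd_lap hf, hN.sum_ricci_mul]
  simp only [hN.pd_hess hf, Finset.sum_sub_distrib, third_comm]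
  ring

lemma divg_hessGrad (hN : IsNormalAt G U p) (hf : ContDiffOn ℝ ∞ f U)
    (hh : ContDiffOn ℝ ∞ h U) :
    divg G (hessGrad G f h) p =
      contract G (fun i j => hess G f i j p) (fun i j => hess G h i j p) p
        + ∑ i, pd i (lap G f) p * grad G h i p
        + ∑ i, ∑ j, ricci G i j p * grad G h i p * grad G f j p := by
  have leibniz : ∀ i, pd i (hessGrad G f h i) p = _ := fun i =>
    hN.pd_raise (hN.metric.contDiffOn_hess hf) (hN.metric.contDiffOn_grad hh) i i
  rw [hN.divg_eq, hN.contract_eq]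
  simp only [leibniz, hN.grad_eq, hN.pd_grad hh, Finset.sum_add_distrib]
  rw [Finset.sum_comm (f := fun i k => pd i (hess G f i k) p * pd k h p)]
  simp only [← Finset.sum_mul, hN.sum_pd_hess hf, add_mul, Finset.sum_add_distrib, hN.hess_eq]
  simp only [Finset.sum_mul, mul_right_comm _ (pd _ h p) (pd _ f p)]
  ring

end IsNormalAt

end NormalCoordinates

/-! ### Existence of normal coordinates -/

section QuadraticMap

variable {X : Type*} [NormedAddCommGroup X] [NormedSpace ℝ X] {p : X} {L : X →L[ℝ] X}
  {C : X →L[ℝ] X →L[ℝ] X}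

/-- The inverse `z ↦ p + Lz - ½ C(Lz, Lz)` of a normal chart up to second order: `C` is to be the
connection at `p`, and `L` an isometry from the Euclidean space onto the tangent space at `p`. -/
def normalParam (p : X) (L : X →L[ℝ] X) (C : X →L[ℝ] X →L[ℝ] X) (z : X) : X :=
  p + L z - (1 / 2 : ℝ) • C (L z) (L z)

lemma normalParam_zero : normalParam p L C 0 = p := by simp [normalParam]

lemma contDiff_normalParam : ContDiff ℝ ∞ (normalParam p L C) := by
  unfold normalParam
  fun_prop

lemma fderiv_normalParam (hC : ∀ u v, C u v = C v u) (z u : X) :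
    fderiv ℝ (normalParam p L C) z u = L u - C (L z) (L u) := by
  have hlin : fderiv ℝ L z = L := L.fderiv
  have hquad : fderiv ℝ (fun z => C (L z) (L z)) z u = C (L u) (L z) + C (L z) (L u) := by
    rw [fderiv_apply₂ (F := fun _ => C) (differentiableAt_const C) L.differentiableAt
      L.differentiableAt]
    simp
  unfold normalParam
  rw [fderiv_fun_sub (by fun_prop) (by fun_prop), fderiv_const_add,
    fderiv_fun_const_smul (by fun_prop), sub_apply, smul_apply, hquad, hC (L u), hlin,
    ← two_smul ℝ, smul_smul]
  norm_num

lemma fderiv_normalParam_zero (hC : ∀ u v, C u v = C v u) :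
    fderiv ℝ (normalParam p L C) 0 = L :=
  ContinuousLinearMap.ext fun u => by simp [fderiv_normalParam hC]

lemma fderiv_fderiv_normalParam (hC : ∀ u v, C u v = C v u) (z u v : X) :
    fderiv ℝ (fderiv ℝ (normalParam p L C)) z u v = -C (L u) (L v) := by
  have hlin : fderiv ℝ L z = L := L.fderiv
  have hsmooth := contDiffOn_fderiv isOpen_univ (contDiff_normalParam (p := p) (L := L)
    (C := C)).contDiffOn
  rw [← fderiv_apply_const (differentiableAt_of_contDiffOn isOpen_univ hsmooth (Set.mem_univ z))]
  simp only [fderiv_normalParam hC]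
  rw [fderiv_const_sub, neg_apply, fderiv_apply₂ (F := fun _ => C) (u := L) (v := fun _ => L v)
    (differentiableAt_const C) L.differentiableAt (differentiableAt_const _), hlin]
  simp

end QuadraticMap

section Existence

variable {n : ℕ} {U V : Set (E n)} {f h f' h' : E n → ℝ} {G G' : E n → Matrix (Fin n) (Fin n) ℝ}
  {y p : E n} {Φ : E n → E n}

open scoped MatrixOrder Matrix.Norms.L2Operator in
lemma exists_transpose_mul_mul_eq_one {ι : Type*} [Fintype ι] [DecidableEq ι] {A : Matrix ι ι ℝ}
    (hA : A.PosDef) : ∃ B : Matrix ι ι ℝ, Bᵀ * A * B = 1 := by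
  obtain ⟨C, hC, rfl⟩ := CStarAlgebra.isStrictlyPositive_iff_eq_star_mul_self.mp
    hA.isStrictlyPositive
  have hdet : IsUnit C.det := (Matrix.isUnit_iff_isUnit_det C).1 hC
  have hdetT : IsUnit (Cᵀ).det := by rwa [Matrix.det_transpose]
  refine ⟨C⁻¹, ?_⟩
  rw [Matrix.star_eq_conjTranspose, Matrix.conjTranspose_eq_transpose_of_trivial,
    Matrix.transpose_nonsing_inv, ← Matrix.mul_assoc, Matrix.nonsing_inv_mul _ hdetT,
    Matrix.one_mul, Matrix.mul_nonsing_inv _ hdet]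

lemma contDiffOn_jac (hV : IsOpen V) (hΦ : ContDiffOn ℝ ∞ Φ V) (k i : Fin n) :
    ContDiffOn ℝ ∞ (fun y => jac Φ y k i) V :=
  (contDiffOn_piLp 2).1 ((contDiffOn_fderiv hV hΦ).clm_apply contDiffOn_const) k

namespace IsMetricOn

lemma isPullback (hG : IsMetricOn G U) (hV : IsOpen V) (hΦ : ContDiffOn ℝ ∞ Φ V)
    (hmaps : Set.MapsTo Φ V U) (hdet : ∀ z ∈ V, (jac Φ z).det ≠ 0) :
    IsPullback Φ (fun z => (jac Φ z)ᵀ * G (Φ z) * jac Φ z) V G U where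
  source :=
    { isOpen := hV
      contDiffOn := fun i j => by
        simp only [Matrix.mul_apply, Matrix.transpose_apply]
        exact ContDiffOn.sum fun l _ => (ContDiffOn.sum fun k _ =>
          (contDiffOn_jac hV hΦ k i).mul ((hG.contDiffOn k l).comp hΦ hmaps)).mul
            (contDiffOn_jac hV hΦ l j)
      posDef := fun z hz => by
        have := (hG.posDef _ (hmaps hz)).conjTranspose_mul_mul_same (B := jac Φ z)
          (Matrix.mulVec_injective_of_isUnit
            ((Matrix.isUnit_iff_isUnit_det _).2 (hdet z hz).isUnit))
        rwa [Matrix.conjTranspose_eq_transpose_of_trivial] at this }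
  target := hG
  contDiffOn := hΦ
  mapsTo := hmaps
  entry := fun z _ i j => by
    have h := congrFun₂ (of_bilinear_fderiv (Φ := Φ) (y := z) (metricForm G (Φ z)).toBilinForm) i j
    simp only [ContinuousLinearMap.toBilinForm_apply, metricForm_stdVec] at h
    exact h.symm

lemma pd_entry_eq_zero (hG : IsMetricOn G U) (hy : y ∈ U) (hconn : ∀ u v, connForm G y u v = 0)
    (i j k : Fin n) : pd k (fun z => G z i j) y = 0 := by
  rw [hG.pd_entry hy, hG.fderiv_metricForm hy, hconn, hconn, map_zero, map_zero, zero_apply,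
    add_zero]

lemma exists_isNormalAt (hG : IsMetricOn G U) (hp : p ∈ U) :
    ∃ (Φ : E n → E n) (G' : E n → Matrix (Fin n) (Fin n) ℝ) (V : Set (E n)) (z : E n),
      IsPullback Φ G' V G U ∧ IsNormalAt G' V z ∧ Φ z = p := by
  obtain ⟨B, hB⟩ := exists_transpose_mul_mul_eq_one (hG.posDef p hp)
  let L : E n →L[ℝ] E n := Matrix.toEuclideanCLM (𝕜 := ℝ) B
  let Φ : E n → E n := normalParam p L (connForm G p)
  have hΦ : ContDiff ℝ ∞ Φ := contDiff_normalParam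
  have hΦ0 : Φ 0 = p := normalParam_zero
  have fderiv_zero : fderiv ℝ Φ 0 = L := fderiv_normalParam_zero (hG.connForm_comm hp)
  have jac_zero : jac Φ 0 = B := by
    ext k i
    simp [jac, fderiv_zero, L]
  have hB_det : B.det ≠ 0 := fun h => by simpa [h] using congrArg Matrix.det hB
  have continuous_det : Continuous fun z => (jac Φ z).det :=
    continuousOn_univ.1 (contDiffOn_det (contDiffOn_jac isOpen_univ hΦ.contDiffOn)).continuousOn
  let V : Set (E n) := Φ ⁻¹' U ∩ {z | (jac Φ z).det ≠ 0}
  have hV : IsOpen V :=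
    (hG.isOpen.preimage hΦ.continuous).inter (isOpen_ne.preimage continuous_det)
  have zero_mem : (0 : E n) ∈ V := ⟨by rwa [Set.mem_preimage, hΦ0], by rwa [← jac_zero] at hB_det⟩
  have hP := hG.isPullback hV hΦ.contDiffOn (fun z hz => hz.1) (fun z hz => hz.2)
  refine ⟨Φ, _, V, 0, hP, ⟨hP.source, zero_mem, by simp only [jac_zero, hΦ0, hB], ?_⟩, hΦ0⟩
  refine hP.source.pd_entry_eq_zero zero_mem fun u v => hP.fderiv_injective zero_mem ?_
  rw [hP.connForm_eq zero_mem, fderiv_fderiv_normalParam (hG.connForm_comm hp), fderiv_zero, hΦ0,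
    neg_add_cancel, map_zero]

end IsMetricOn

lemma IsPullback.hessGrad_eq (hP : IsPullback Φ G' V G U) (hf : ContDiffOn ℝ ∞ f U)
    (hff : Set.EqOn f' (fun z => f (Φ z)) V) (hh : ContDiffOn ℝ ∞ h U)
    (hhh : Set.EqOn h' (fun z => h (Φ z)) V) (hy : y ∈ V) :
    jac Φ y *ᵥ (fun i => hessGrad G' f' h' i y) = fun i => hessGrad G f h i (Φ y) :=
  hP.raise_eq hy (hP.hess_eq hf hff hy) (hP.grad_eq hh hhh hy)

lemma sum_mul_mul_eq_of_congruence {ι : Type*} [Fintype ι] {A : Matrix ι ι ℝ} {S S' : ι → ι → ℝ}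
    {v v' w w' : ι → ℝ} (hS : Matrix.of S' = Aᵀ * Matrix.of S * A) (hv : A *ᵥ v' = v)
    (hw : A *ᵥ w' = w) :
    ∑ i, ∑ j, S' i j * v' i * w' j = ∑ i, ∑ j, S i j * v i * w j := by
  have sum_eq_dotProduct : ∀ (S : ι → ι → ℝ) (v w : ι → ℝ),
      ∑ i, ∑ j, S i j * v i * w j = v ⬝ᵥ (Matrix.of S *ᵥ w) := fun S v w => by
    simp only [Matrix.mulVec, dotProduct, Finset.mul_sum, Matrix.of_apply]
    exact Finset.sum_congr rfl fun i _ => Finset.sum_congr rfl fun j _ => by ring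
  rw [sum_eq_dotProduct, sum_eq_dotProduct, hS, ← hv, ← hw, Matrix.mul_assoc,
    ← Matrix.mulVec_mulVec, ← Matrix.mulVec_mulVec, Matrix.dotProduct_mulVec,
    Matrix.vecMul_transpose]

namespace IsMetricOn

lemma divg_grad (hG : IsMetricOn G U) (hh : ContDiffOn ℝ ∞ h U) (hy : y ∈ U) :
    divg G (grad G h) y = lap G h y := by
  obtain ⟨Φ, G', V, z, hP, hN, rfl⟩ := hG.exists_isNormalAt hy
  have hh' := hP.contDiffOn_comp hh
  rw [← hP.lap_eq hh (fun _ _ => rfl) hN.mem, ← hN.divg_grad hh']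
  exact (hP.divg_eq hN.mem (hG.contDiffOn_grad hh) (hP.source.contDiffOn_grad hh')
    fun w hw => hP.grad_eq hh (fun _ _ => rfl) hw).symm

lemma divg_schoutenGrad (hG : IsMetricOn G U) (hn : 2 < n)
    (hf : ContDiffOn ℝ ∞ f U) (hy : y ∈ U) :
    divg G (schoutenGrad G f) y =
      contract G (fun i j => schouten G i j y) (fun i j => hess G f i j y) y
        + ∑ i, pd i (locJ G) y * grad G f i y := by
  obtain ⟨Φ, G', V, z, hP, hN, rfl⟩ := hG.exists_isNormalAt hy
  have hf' := hP.contDiffOn_comp hf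
  have hff : Set.EqOn (fun z => f (Φ z)) (fun z => f (Φ z)) V := fun _ _ => rfl
  have normal := hN.divg_schoutenGrad hn hf'
  rwa [hP.divg_eq hN.mem (hG.contDiffOn_schoutenGrad hf) (hP.source.contDiffOn_schoutenGrad hf')
      fun w hw => hP.schoutenGrad_eq hf hff hw,
    hP.contract_eq hN.mem (hP.schouten_eq hN.mem) (hP.hess_eq hf hff hN.mem),
    hP.sum_pd_mul_eq hG.contDiffOn_locJ (fun w hw => hP.locJ_eq hw) hN.mem
      (hP.grad_eq hf hff hN.mem)] at normal

lemma divg_hessGrad (hG : IsMetricOn G U) (hf : ContDiffOn ℝ ∞ f U)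
    (hh : ContDiffOn ℝ ∞ h U) (hy : y ∈ U) :
    divg G (hessGrad G f h) y =
      contract G (fun i j => hess G f i j y) (fun i j => hess G h i j y) y
        + ∑ i, pd i (lap G f) y * grad G h i y
        + ∑ i, ∑ j, ricci G i j y * grad G h i y * grad G f j y := by
  obtain ⟨Φ, G', V, z, hP, hN, rfl⟩ := hG.exists_isNormalAt hy
  have hf' := hP.contDiffOn_comp hf
  have hh' := hP.contDiffOn_comp hh
  have hff : Set.EqOn (fun z => f (Φ z)) (fun z => f (Φ z)) V := fun _ _ => rfl
  have hhh : Set.EqOn (fun z => h (Φ z)) (fun z => h (Φ z)) V := fun _ _ => rfl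
  have normal := hN.divg_hessGrad hf' hh'
  rwa [hP.divg_eq hN.mem (hG.contDiffOn_hessGrad hf hh) (hP.source.contDiffOn_hessGrad hf' hh')
      fun w hw => hP.hessGrad_eq hf hff hh hhh hw,
    hP.contract_eq hN.mem (hP.hess_eq hf hff hN.mem) (hP.hess_eq hh hhh hN.mem),
    hP.sum_pd_mul_eq (hG.contDiffOn_lap hf) (fun w hw => hP.lap_eq hf hff hw) hN.mem
      (hP.grad_eq hh hhh hN.mem),
    sum_mul_mul_eq_of_congruence (hP.ricci_eq hN.mem) (hP.grad_eq hh hhh hN.mem)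
      (hP.grad_eq hf hff hN.mem)] at normal

end IsMetricOn

end Existence

/-! ### The bilinear form of `H` -/

section DivergenceForm

variable {n : ℕ} {U V : Set (E n)} {f f' h h' u : E n → ℝ}
  {G G' : E n → Matrix (Fin n) (Fin n) ℝ} {X Y : Fin n → E n → ℝ} {y : E n} {Φ : E n → E n}
  {lam : ℝ}

lemma divg_add (hX : ∀ i, DifferentiableAt ℝ (X i) y) (hY : ∀ i, DifferentiableAt ℝ (Y i) y) :
    divg G (fun i z => X i z + Y i z) y = divg G X y + divg G Y y := by
  simp only [divg, fun i => pd_add (hX i) (hY i), mul_add, Finset.sum_add_distrib]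
  ring

lemma divg_mul (hu : DifferentiableAt ℝ u y) (hX : ∀ i, DifferentiableAt ℝ (X i) y) :
    divg G (fun i z => u z * X i z) y = ∑ i, pd i u y * X i y + u y * divg G X y := by
  simp only [divg, fun i => pd_mul hu (hX i), Finset.sum_add_distrib, mul_add, Finset.mul_sum,
    mul_left_comm (u y)]
  ring

lemma divg_const_mul (a : ℝ) (hX : ∀ i, DifferentiableAt ℝ (X i) y) :
    divg G (fun i z => a * X i z) y = a * divg G X y := by
  simp [divg_mul (differentiableAt_const a) hX, pd_const]

lemma divg_sub (hX : ∀ i, DifferentiableAt ℝ (X i) y) (hY : ∀ i, DifferentiableAt ℝ (Y i) y) :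
    divg G (fun i z => X i z - Y i z) y = divg G X y - divg G Y y := by
  simp only [divg, fun i => pd_sub (hX i) (hY i), mul_sub, Finset.sum_sub_distrib]
  ring

/-- The inner product `⟨∇f, ∇h⟩`. -/
def gradInner (G : E n → Matrix (Fin n) (Fin n) ℝ) (f h : E n → ℝ) (y : E n) : ℝ :=
  ∑ i, pd i f y * grad G h i y

/-- The weight `t` for which the Ricci term of Bochner's formula for `t⟨D²f, D²h⟩` cancels the
term `(4 - λ) A(∇f, ∇h)` of `H`. -/
def hessWeight (n : ℕ) (lam : ℝ) : ℝ :=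
  (4 - lam) / ((n : ℝ) - 2)

/-- The symmetric bilinear form that represents `∫ Hf · h`. -/
def energyDensity (G : E n → Matrix (Fin n) (Fin n) ℝ) (lam : ℝ) (f h : E n → ℝ) (y : E n) : ℝ :=
  (1 - hessWeight n lam) * (lap G f y * lap G h y)
    + hessWeight n lam * contract G (fun i j => hess G f i j y) (fun i j => hess G h i j y) y
    + (hessWeight n lam + (n - 2 - lam)) * (locJ G y * gradInner G f h y)
    + ((n : ℝ) - 4) / 2 * (locQ G y - lam * locSigmaTwo G y) * (f y * h y)

/-- The vector field `∇Δf + (4 - λ) A(∇f) - (n - 2 - λ) J ∇f`, whose divergence is the part of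
`Hf` that involves derivatives of `f`. -/
def principalField (G : E n → Matrix (Fin n) (Fin n) ℝ) (lam : ℝ) (f : E n → ℝ) (i : Fin n)
    (y : E n) : ℝ :=
  grad G (lap G f) i y
    + ((4 - lam) * schoutenGrad G f i y - ((n : ℝ) - 2 - lam) * (locJ G y * grad G f i y))

/-- The vector field `(1 - t) Δf ∇h + t D²f(∇h)`, where `t = hessWeight n lam`. -/
def bochnerField (G : E n → Matrix (Fin n) (Fin n) ℝ) (lam : ℝ) (f h : E n → ℝ) (i : Fin n)
    (y : E n) : ℝ :=
  (1 - hessWeight n lam) * (lap G f y * grad G h i y) + hessWeight n lam * hessGrad G f h i y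

/-- The vector field whose divergence is `Hf · h` minus the energy density. -/
def fluxField (G : E n → Matrix (Fin n) (Fin n) ℝ) (lam : ℝ) (f h : E n → ℝ) (i : Fin n)
    (y : E n) : ℝ :=
  h y * principalField G lam f i y - bochnerField G lam f h i y

lemma hessWeight_mul (hn : 2 < n) (lam : ℝ) : hessWeight n lam * ((n : ℝ) - 2) = 4 - lam :=
  div_mul_cancel₀ _ (sub_ne_zero.2 (by exact_mod_cast hn.ne'))

namespace IsMetricOn

lemma sum_pd_mul_inv (hG : IsMetricOn G U) (hy : y ∈ U) (f : E n → ℝ) (j : Fin n) :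
    ∑ i, pd i f y * (G y)⁻¹ i j = grad G f j y :=
  Finset.sum_congr rfl fun i _ => by rw [hG.inv_entry_comm hy, mul_comm]

lemma sum_mul_grad (hG : IsMetricOn G U) (hy : y ∈ U) (f : E n → ℝ) (i : Fin n) :
    ∑ j, G y i j * grad G f j y = pd i f y := by
  have lower : G y *ᵥ ((G y)⁻¹ *ᵥ fun k => pd k f y) = fun k => pd k f y := by
    rw [Matrix.mulVec_mulVec, Matrix.mul_nonsing_inv _ (hG.isUnit_det hy), Matrix.one_mulVec]
  exact congrFun lower i

lemma gradInner_comm (hG : IsMetricOn G U) (hy : y ∈ U) (f h : E n → ℝ) :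
    gradInner G f h y = gradInner G h f y := by
  simp only [gradInner, ← hG.sum_pd_mul_inv hy h, Finset.mul_sum]
  rw [Finset.sum_comm]
  exact Finset.sum_congr rfl fun j _ => by
    simp only [grad, Finset.mul_sum]
    exact Finset.sum_congr rfl fun i _ => by ring

lemma sum_pd_mul_schoutenGrad (hG : IsMetricOn G U) (hy : y ∈ U) (f h : E n → ℝ) :
    ∑ i, pd i h y * schoutenGrad G f i y =
      ∑ i, ∑ j, schouten G i j y * grad G h i y * grad G f j y := by
  simp only [schoutenGrad, ← hG.sum_pd_mul_inv hy h, Finset.mul_sum, Finset.sum_mul]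
  rw [Finset.sum_comm]
  refine Finset.sum_congr rfl fun i _ => ?_
  rw [Finset.sum_comm]
  exact Finset.sum_congr rfl fun j _ => Finset.sum_congr rfl fun k _ => by ring

lemma sum_ricci_mul_grad_mul_grad (hG : IsMetricOn G U) (hn : 2 < n) (hy : y ∈ U)
    (f h : E n → ℝ) :
    ∑ i, ∑ j, ricci G i j y * grad G h i y * grad G f j y =
      ((n : ℝ) - 2) * ∑ i, pd i h y * schoutenGrad G f i y + locJ G y * gradInner G f h y := by
  have ricci_eq : ∀ i j, ricci G i j y = ((n : ℝ) - 2) * schouten G i j y + locJ G y * G y i j :=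
    fun i j => by
      have : (n : ℝ) - 2 ≠ 0 := sub_ne_zero.2 (by exact_mod_cast hn.ne')
      rw [schouten]
      field_simp
      ring
  rw [hG.sum_pd_mul_schoutenGrad hy, gradInner]
  simp only [← hG.sum_mul_grad hy f, ricci_eq, Finset.mul_sum, Finset.sum_mul]
  simp only [← Finset.sum_add_distrib]
  exact Finset.sum_congr rfl fun i _ => Finset.sum_congr rfl fun j _ => by ring

lemma contDiffOn_principalField (hG : IsMetricOn G U) (hf : ContDiffOn ℝ ∞ f U) (lam : ℝ)
    (i : Fin n) : ContDiffOn ℝ ∞ (principalField G lam f i) U :=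
  (hG.contDiffOn_grad (hG.contDiffOn_lap hf) i).add
    ((contDiffOn_const.mul (hG.contDiffOn_schoutenGrad hf i)).sub
      (contDiffOn_const.mul (hG.contDiffOn_locJ.mul (hG.contDiffOn_grad hf i))))

lemma contDiffOn_bochnerField (hG : IsMetricOn G U) (hf : ContDiffOn ℝ ∞ f U)
    (hh : ContDiffOn ℝ ∞ h U) (lam : ℝ) (i : Fin n) :
    ContDiffOn ℝ ∞ (bochnerField G lam f h i) U :=
  (contDiffOn_const.mul ((hG.contDiffOn_lap hf).mul (hG.contDiffOn_grad hh i))).add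
    (contDiffOn_const.mul (hG.contDiffOn_hessGrad hf hh i))

lemma contDiffOn_fluxField (hG : IsMetricOn G U) (hf : ContDiffOn ℝ ∞ f U)
    (hh : ContDiffOn ℝ ∞ h U) (lam : ℝ) (i : Fin n) :
    ContDiffOn ℝ ∞ (fluxField G lam f h i) U :=
  (hh.mul (hG.contDiffOn_principalField hf lam i)).sub (hG.contDiffOn_bochnerField hf hh lam i)

lemma divg_mul_grad (hG : IsMetricOn G U) (hu : ContDiffOn ℝ ∞ u U) (hf : ContDiffOn ℝ ∞ f U)
    (hy : y ∈ U) :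
    divg G (fun i z => u z * grad G f i z) y = gradInner G u f y + u y * lap G f y := by
  rw [divg_mul (hG.differentiableAt hu hy)
    fun i => hG.differentiableAt (hG.contDiffOn_grad hf i) hy, hG.divg_grad hf hy,
    gradInner]

lemma divg_schoutenGrad_sub (hG : IsMetricOn G U) (hf : ContDiffOn ℝ ∞ f U) (hy : y ∈ U)
    (a b : ℝ) :
    divg G (fun i z => a * schoutenGrad G f i z - b * (locJ G z * grad G f i z)) y =
      a * divg G (schoutenGrad G f) y - b * (gradInner G (locJ G) f y + locJ G y * lap G f y) := by
  have hA := fun i => hG.differentiableAt (hG.contDiffOn_schoutenGrad hf i) hy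
  have hJ := fun i => hG.differentiableAt
    (hG.contDiffOn_locJ.mul (hG.contDiffOn_grad hf i)) hy
  rw [divg_sub (fun i => (hA i).const_mul a) (fun i => (hJ i).const_mul b), divg_const_mul a hA,
    divg_const_mul b hJ, hG.divg_mul_grad hG.contDiffOn_locJ hf hy]

lemma divg_principalField (hG : IsMetricOn G U) (hf : ContDiffOn ℝ ∞ f U) (hy : y ∈ U) :
    divg G (principalField G lam f) y =
      lap G (lap G f) y + ((4 - lam) * divg G (schoutenGrad G f) y
        - ((n : ℝ) - 2 - lam) * (gradInner G (locJ G) f y + locJ G y * lap G f y)) := by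
  have hL := hG.contDiffOn_grad (hG.contDiffOn_lap hf)
  rw [← hG.divg_schoutenGrad_sub hf hy, ← hG.divg_grad (hG.contDiffOn_lap hf) hy]
  exact divg_add (fun i => hG.differentiableAt (hL i) hy) fun i =>
    hG.differentiableAt ((contDiffOn_const.mul (hG.contDiffOn_schoutenGrad hf i)).sub
      (contDiffOn_const.mul (hG.contDiffOn_locJ.mul (hG.contDiffOn_grad hf i)))) hy

lemma locH_eq_divg_add (hG : IsMetricOn G U) (hn : 2 < n) (hf : ContDiffOn ℝ ∞ f U) (hy : y ∈ U) :
    locH G lam f y = divg G (principalField G lam f) y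
      + ((n : ℝ) - 4) / 2 * (locQ G y - lam * locSigmaTwo G y) * f y := by
  -- By the contracted Bianchi identity `⟨A, D²f⟩ - JΔf` is the divergence of `A(∇f) - J∇f`.
  have bianchi := hG.divg_schoutenGrad hn hf hy
  rw [← gradInner] at bianchi
  rw [hG.divg_principalField hf hy, locH, locP]
  simp only [mul_assoc ((n : ℝ) - 2)]
  rw [hG.divg_schoutenGrad_sub hf hy, bianchi]
  ring

lemma sum_pd_mul_principalField (hG : IsMetricOn G U) (hy : y ∈ U) :
    ∑ i, pd i h y * principalField G lam f i y =
      gradInner G (lap G f) h y + ((4 - lam) * ∑ i, pd i h y * schoutenGrad G f i y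
        - ((n : ℝ) - 2 - lam) * (locJ G y * gradInner G f h y)) := by
  rw [hG.gradInner_comm hy (lap G f), hG.gradInner_comm hy f]
  simp only [gradInner, principalField, Finset.mul_sum, ← Finset.sum_add_distrib,
    ← Finset.sum_sub_distrib]
  exact Finset.sum_congr rfl fun i _ => by ring

lemma divg_bochnerField (hG : IsMetricOn G U) (hn : 2 < n) (hf : ContDiffOn ℝ ∞ f U)
    (hh : ContDiffOn ℝ ∞ h U) (hy : y ∈ U) :
    divg G (bochnerField G lam f h) y =
      (1 - hessWeight n lam) * (lap G f y * lap G h y)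
        + hessWeight n lam * contract G (fun i j => hess G f i j y) (fun i j => hess G h i j y) y
        + gradInner G (lap G f) h y + (4 - lam) * ∑ i, pd i h y * schoutenGrad G f i y
        + hessWeight n lam * (locJ G y * gradInner G f h y) := by
  have hL := fun i => hG.differentiableAt
    ((hG.contDiffOn_lap hf).mul (hG.contDiffOn_grad hh i)) hy
  have hH := fun i => hG.differentiableAt (hG.contDiffOn_hessGrad hf hh i) hy
  have bochner := hG.divg_hessGrad hf hh hy
  rw [← gradInner, hG.sum_ricci_mul_grad_mul_grad hn hy] at bochner
  calc divg G (bochnerField G lam f h) y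
      = (1 - hessWeight n lam) * (gradInner G (lap G f) h y + lap G f y * lap G h y)
        + hessWeight n lam * divg G (hessGrad G f h) y := by
        rw [← hG.divg_mul_grad (hG.contDiffOn_lap hf) hh hy, ← divg_const_mul _ hL,
          ← divg_const_mul _ hH]
        exact divg_add (fun i => (hL i).const_mul _) fun i => (hH i).const_mul _
    _ = _ := by
        rw [bochner, ← hessWeight_mul hn lam]
        ring

lemma locH_mul_eq (hG : IsMetricOn G U) (hn : 2 < n) (hf : ContDiffOn ℝ ∞ f U)
    (hh : ContDiffOn ℝ ∞ h U) (hy : y ∈ U) :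
    locH G lam f y * h y = energyDensity G lam f h y + divg G (fluxField G lam f h) y := by
  have hW := fun i => hG.differentiableAt (hG.contDiffOn_principalField hf lam i) hy
  have hB := fun i => hG.differentiableAt (hG.contDiffOn_bochnerField hf hh lam i) hy
  have hhy := hG.differentiableAt hh hy
  have flux : divg G (fluxField G lam f h) y = ∑ i, pd i h y * principalField G lam f i y
      + h y * divg G (principalField G lam f) y - divg G (bochnerField G lam f h) y := by
    rw [← divg_mul hhy hW]
    exact divg_sub (fun i => hhy.fun_mul (hW i)) hB
  rw [flux, hG.locH_eq_divg_add hn hf hy, hG.sum_pd_mul_principalField hy,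
    hG.divg_bochnerField hn hf hh hy, energyDensity]
  ring

lemma contract_comm (hG : IsMetricOn G U) (hy : y ∈ U) (S T : Fin n → Fin n → ℝ) :
    contract G S T y = contract G T S y := by
  have inv_transpose : ((G y)⁻¹)ᵀ = (G y)⁻¹ := by
    ext i j
    exact hG.inv_entry_comm hy j i
  rw [contract_eq_trace, contract_eq_trace, ← Matrix.trace_transpose]
  simp only [Matrix.transpose_mul, Matrix.transpose_transpose, inv_transpose]
  rw [Matrix.trace_mul_comm]
  simp only [Matrix.mul_assoc]

lemma energyDensity_comm (hG : IsMetricOn G U) (hy : y ∈ U) (lam : ℝ) (f h : E n → ℝ) :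
    energyDensity G lam f h y = energyDensity G lam h f y := by
  rw [energyDensity, energyDensity, hG.contract_comm hy, hG.gradInner_comm hy,
    mul_comm (lap G f y), mul_comm (f y)]

lemma gradInner_self_nonneg (hG : IsMetricOn G U) (hf : ContDiffOn ℝ ∞ f U) (hy : y ∈ U) :
    0 ≤ gradInner G f f y := by
  obtain ⟨Φ, G', V, z, hP, hN, rfl⟩ := hG.exists_isNormalAt hy
  rw [gradInner, ← hP.sum_pd_mul_eq hf (fun _ _ => rfl) hN.mem
    (hP.grad_eq hf (fun _ _ => rfl) hN.mem)]
  simp only [hN.grad_eq]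
  exact Finset.sum_nonneg fun i _ => mul_self_nonneg _

lemma contract_hess_self_nonneg (hG : IsMetricOn G U) (hf : ContDiffOn ℝ ∞ f U) (hy : y ∈ U) :
    0 ≤ contract G (fun i j => hess G f i j y) (fun i j => hess G f i j y) y := by
  obtain ⟨Φ, G', V, z, hP, hN, rfl⟩ := hG.exists_isNormalAt hy
  have hD := hP.hess_eq hf (fun _ _ => rfl) hN.mem
  rw [← hP.contract_eq hN.mem hD hD, hN.contract_eq]
  exact Finset.sum_nonneg fun i _ => Finset.sum_nonneg fun j _ => mul_self_nonneg _

lemma le_energyDensity_self (hG : IsMetricOn G U) (hf : ContDiffOn ℝ ∞ f U) (hy : y ∈ U)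
    (hJ : 0 ≤ locJ G y) (ht₀ : 0 ≤ hessWeight n lam) (ht₁ : hessWeight n lam ≤ 1)
    (hgrad : 0 ≤ hessWeight n lam + (n - 2 - lam)) :
    ((n : ℝ) - 4) / 2 * (locQ G y - lam * locSigmaTwo G y) * f y ^ 2 ≤
      energyDensity G lam f f y := by
  have hLap := mul_nonneg (sub_nonneg.2 ht₁) (mul_self_nonneg (lap G f y))
  have hHess := mul_nonneg ht₀ (hG.contract_hess_self_nonneg hf hy)
  have hGrad := mul_nonneg hgrad (mul_nonneg hJ (hG.gradInner_self_nonneg hf hy))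
  rw [energyDensity, ← pow_two (f y)]
  linarith

lemma contDiffOn_gradInner (hG : IsMetricOn G U) (hf : ContDiffOn ℝ ∞ f U)
    (hh : ContDiffOn ℝ ∞ h U) : ContDiffOn ℝ ∞ (gradInner G f h) U :=
  ContDiffOn.sum fun i _ => (contDiffOn_pd hG.isOpen hf i).mul (hG.contDiffOn_grad hh i)

lemma contDiffOn_locQ_sub (hG : IsMetricOn G U) (lam : ℝ) :
    ContDiffOn ℝ ∞ (fun y => locQ G y - lam * locSigmaTwo G y) U :=
  hG.contDiffOn_locQ.sub (contDiffOn_const.mul hG.contDiffOn_locSigmaTwo)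

lemma contDiffOn_energyDensity (hG : IsMetricOn G U) (hf : ContDiffOn ℝ ∞ f U)
    (hh : ContDiffOn ℝ ∞ h U) (lam : ℝ) : ContDiffOn ℝ ∞ (energyDensity G lam f h) U :=
  (((contDiffOn_const.mul ((hG.contDiffOn_lap hf).mul (hG.contDiffOn_lap hh))).add
    (contDiffOn_const.mul
      (hG.contDiffOn_contract (hG.contDiffOn_hess hf) (hG.contDiffOn_hess hh)))).add
    (contDiffOn_const.mul (hG.contDiffOn_locJ.mul (hG.contDiffOn_gradInner hf hh)))).add
    ((contDiffOn_const.mul (hG.contDiffOn_locQ_sub lam)).mul (hf.mul hh))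

lemma hess_add (hG : IsMetricOn G U) (hh : ContDiffOn ℝ ∞ h U) (hu : ContDiffOn ℝ ∞ u U)
    (hy : y ∈ U) (i j : Fin n) :
    hess G (fun z => h z + u z) i j y = hess G h i j y + hess G u i j y := by
  have pd_fun_add : ∀ k, Set.EqOn (pd k fun z => h z + u z) (fun z => pd k h z + pd k u z) U :=
    fun k z hz => pd_add (hG.differentiableAt hh hz)
      (hG.differentiableAt hu hz) k
  have pd_pd := (eqOn_pd hG.isOpen (pd_fun_add j) i hy).trans
    (pd_add (hG.differentiableAt (contDiffOn_pd hG.isOpen hh j) hy)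
      (hG.differentiableAt (contDiffOn_pd hG.isOpen hu j) hy) i)
  simp only [hess, pd_pd, fun k => pd_fun_add k hy, mul_add, Finset.sum_add_distrib]
  ring

lemma energyDensity_add (hG : IsMetricOn G U) (hh : ContDiffOn ℝ ∞ h U) (hu : ContDiffOn ℝ ∞ u U)
    (hy : y ∈ U) (lam : ℝ) (f : E n → ℝ) :
    energyDensity G lam f (fun z => h z + u z) y =
      energyDensity G lam f h y + energyDensity G lam f u y := by
  have pd_fun_add := pd_add (hG.differentiableAt hh hy)
    (hG.differentiableAt hu hy)
  simp only [energyDensity, lap, contract, gradInner, grad, hG.hess_add hh hu hy, pd_fun_add,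
    mul_add, Finset.sum_add_distrib]
  ring

end IsMetricOn

lemma energyDensity_eq_zero (hV : IsOpen V) (hh : Set.EqOn h (fun _ => 0) V) (hy : y ∈ V)
    (lam : ℝ) (f : E n → ℝ) : energyDensity G lam f h y = 0 := by
  have pd_eq_zero : ∀ i, Set.EqOn (pd i h) (fun _ => 0) V :=
    fun i z hz => (eqOn_pd hV hh i hz).trans (pd_const i 0)
  have pd_pd_eq_zero : ∀ i j, pd i (pd j h) y = 0 :=
    fun i j => (eqOn_pd hV (pd_eq_zero j) i hy).trans (pd_const i 0)
  simp [energyDensity, lap, gradInner, grad, contract, hess, pd_pd_eq_zero,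
    fun i => pd_eq_zero i hy, hh hy]

lemma fluxField_eq_zero (hV : IsOpen V) (hh : Set.EqOn h (fun _ => 0) V) (hy : y ∈ V)
    (lam : ℝ) (f : E n → ℝ) (i : Fin n) : fluxField G lam f h i y = 0 := by
  have pd_eq_zero : ∀ i, pd i h y = 0 := fun i => (eqOn_pd hV hh i hy).trans (pd_const i 0)
  simp [fluxField, bochnerField, hessGrad, grad, pd_eq_zero, hh hy]

lemma IsPullback.energyDensity_eq (hP : IsPullback Φ G' V G U) (hf : ContDiffOn ℝ ∞ f U)
    (hff : Set.EqOn f' (fun z => f (Φ z)) V) (hh : ContDiffOn ℝ ∞ h U)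
    (hhh : Set.EqOn h' (fun z => h (Φ z)) V) (hy : y ∈ V) (lam : ℝ) :
    energyDensity G' lam f' h' y = energyDensity G lam f h (Φ y) := by
  rw [energyDensity, energyDensity, hP.lap_eq hf hff hy, hP.lap_eq hh hhh hy,
    hP.contract_eq hy (hP.hess_eq hf hff hy) (hP.hess_eq hh hhh hy), hP.locJ_eq hy, gradInner,
    hP.sum_pd_mul_eq hf hff hy (hP.grad_eq hh hhh hy), hP.locQ_eq hy, hP.locSigmaTwo_eq hy,
    hff hy, hhh hy, gradInner]

end DivergenceForm

/-! ### The divergence theorem in coordinates -/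

section Jacobi

variable {ι X : Type*} [Fintype ι] [DecidableEq ι] [NormedAddCommGroup X] [NormedSpace ℝ X]

lemma sum_adjugate_mul (A : Matrix ι ι ℝ) (b : ι → ℝ) (i : ι) :
    ∑ k, A.adjugate i k * b k = ∑ σ : Equiv.Perm ι, ((Equiv.Perm.sign σ : ℤ) : ℝ) *
      ((∏ j ∈ Finset.univ.erase i, A (σ j) j) * b (σ i)) := by
  have cramer_apply_eq := congrFun (Matrix.cramer_eq_adjugate_mulVec A b) i
  simp only [Matrix.mulVec, dotProduct] at cramer_apply_eq
  rw [← cramer_apply_eq, Matrix.cramer_apply, Matrix.det_apply']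
  refine Finset.sum_congr rfl fun σ _ => ?_
  rw [← Finset.mul_prod_erase _ _ (Finset.mem_univ i), Matrix.updateCol_self, mul_comm (b _)]
  congr 2
  exact Finset.prod_congr rfl fun j hj => by
    rw [Matrix.updateCol_ne (Finset.ne_of_mem_erase hj)]

lemma fderiv_det_apply {A : X → Matrix ι ι ℝ} {x : X}
    (hA : ∀ i j, DifferentiableAt ℝ (fun z => A z i j) x) (v : X) :
    fderiv ℝ (fun z => (A z).det) x v =
      ∑ i, ∑ k, (A x).adjugate i k * fderiv ℝ (fun z => A z k i) x v := by
  have hdet : HasFDerivAt (fun z => (A z).det) (∑ σ : Equiv.Perm ι,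
      ((Equiv.Perm.sign σ : ℤ) : ℝ) • ∑ i, (∏ j ∈ Finset.univ.erase i, A x (σ j) j) •
        fderiv ℝ (fun z => A z (σ i) i) x) x := by
    simp only [Matrix.det_apply']
    exact HasFDerivAt.fun_sum fun σ _ => HasFDerivAt.const_mul
      (HasFDerivAt.finsetProd fun i _ => (hA (σ i) i).hasFDerivAt) _
  simp only [fun i => sum_adjugate_mul (A x) (fun k => fderiv ℝ (fun z => A z k i) x v) i]
  rw [Finset.sum_comm, hdet.fderiv]
  simp [Finset.mul_sum]

end Jacobi

section DivergenceTheorem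

variable {n : ℕ} {U K : Set (E n)} {f h w : E n → ℝ} {G : E n → Matrix (Fin n) (Fin n) ℝ}
  {X : Fin n → E n → ℝ} {y : E n} {lam : ℝ}

namespace IsMetricOn

lemma contDiffOn_sqrt_det (hG : IsMetricOn G U) : ContDiffOn ℝ ∞ (fun z => √(G z).det) U :=
  (contDiffOn_det hG.contDiffOn).sqrt fun _ hz => (hG.det_pos hz).ne'

lemma sum_christoffel (hG : IsMetricOn G U) (hy : y ∈ U) (j : Fin n) :
    ∑ i, christoffel G i i j y =
      (1 / 2) * ∑ i, ∑ k, (G y)⁻¹ i k * pd j (fun z => G z k i) y := by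
  have swap_indices : ∑ i, ∑ k, (G y)⁻¹ i k * pd i (fun z => G z j k) y =
      ∑ i, ∑ k, (G y)⁻¹ i k * pd k (fun z => G z i j) y := by
    rw [Finset.sum_comm]
    exact Finset.sum_congr rfl fun i _ => Finset.sum_congr rfl fun k _ => by
      rw [hG.inv_entry_comm hy, hG.pd_entry_comm hy]
  simp only [christoffel, ← Finset.mul_sum, mul_add, mul_sub, Finset.sum_add_distrib,
    Finset.sum_sub_distrib, swap_indices, fun i k => hG.pd_entry_comm hy i k j]
  ring

lemma pd_sqrt_det (hG : IsMetricOn G U) (hy : y ∈ U) (j : Fin n) :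
    pd j (fun z => √(G z).det) y = √(G y).det * ∑ i, christoffel G i i j y := by
  have hdet := hG.differentiableAt (contDiffOn_det hG.contDiffOn) hy
  have hpos := hG.det_pos hy
  have adjugate_eq : (G y).adjugate = (G y).det • (G y)⁻¹ := by
    rw [Matrix.inv_def, smul_smul, Ring.inverse_eq_inv', mul_inv_cancel₀ hpos.ne', one_smul]
  have pd_det : pd j (fun z => (G z).det) y =
      (G y).det * ∑ i, ∑ k, (G y)⁻¹ i k * pd j (fun z => G z k i) y := by
    rw [pd, fderiv_det_apply fun i k => hG.differentiableAt (hG.contDiffOn i k) hy, adjugate_eq]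
    simp only [Matrix.smul_apply, smul_eq_mul, mul_assoc, ← Finset.mul_sum, pd]
  have pd_sqrt : pd j (fun z => √(G z).det) y =
      1 / (2 * √(G y).det) * pd j (fun z => (G z).det) y := by
    rw [pd, (hdet.hasFDerivAt.sqrt hpos.ne').fderiv, smul_apply, smul_eq_mul, pd]
  rw [pd_sqrt, pd_det, hG.sum_christoffel hy]
  have hsqrt : √(G y).det ≠ 0 := (Real.sqrt_pos.2 hpos).ne'
  field_simp
  rw [Real.sq_sqrt hpos.le]

lemma sqrt_det_mul_divg (hG : IsMetricOn G U) (hX : ∀ i, DifferentiableAt ℝ (X i) y)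
    (hy : y ∈ U) :
    √(G y).det * divg G X y = ∑ i, pd i (fun z => √(G z).det * X i z) y := by
  simp only [fun i => pd_mul (hG.differentiableAt hG.contDiffOn_sqrt_det hy) (hX i) i,
    hG.pd_sqrt_det hy, Finset.sum_add_distrib, divg, mul_add, Finset.mul_sum, Finset.sum_mul]
  rw [add_comm]
  congr 1
  rw [Finset.sum_comm]
  exact Finset.sum_congr rfl fun i _ => Finset.sum_congr rfl fun j _ => by ring

end IsMetricOn

lemma eqOn_indicator_compl (hw₀ : Set.EqOn w 0 (U \ K)) : Set.EqOn (U.indicator w) 0 Kᶜ := by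
  intro z hz
  by_cases hzU : z ∈ U
  · rw [Set.indicator_of_mem hzU, hw₀ ⟨hzU, hz⟩]
  · exact Set.indicator_of_notMem hzU w

lemma contDiff_indicator (hU : IsOpen U) (hK : IsClosed K) (hKU : K ⊆ U)
    (hw : ContDiffOn ℝ ∞ w U) (hw₀ : Set.EqOn w 0 (U \ K)) :
    ContDiff ℝ ∞ (U.indicator w) := by
  rw [contDiff_iff_contDiffAt]
  intro z
  by_cases hz : z ∈ U
  · exact (hw.contDiffAt (hU.mem_nhds hz)).congr_of_eventuallyEq
      (Set.eqOn_indicator.eventuallyEq_of_mem (hU.mem_nhds hz))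
  · exact contDiffAt_const.congr_of_eventuallyEq ((eqOn_indicator_compl hw₀).eventuallyEq_of_mem
      (hK.isOpen_compl.mem_nhds fun h => hz (hKU h)))

lemma integral_pd_eq_zero (hw : ContDiff ℝ ∞ w) (hc : HasCompactSupport w) (i : Fin n) :
    Integrable (pd i w) ∧ ∫ z, pd i w z = 0 := by
  have integrable_pd : Integrable fun z => fderiv ℝ w z (stdVec i) :=
    ((hw.continuous_fderiv (by simp)).clm_apply continuous_const).integrable_of_hasCompactSupport
      (hc.fderiv_apply (𝕜 := ℝ) _)
  refine ⟨integrable_pd, ?_⟩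
  have by_parts := integral_mul_fderiv_eq_neg_fderiv_mul_of_integrable
    (μ := (volume : Measure (E n))) (f := fun _ => (1 : ℝ)) (g := w) (v := stdVec i) (by simp)
    (by simpa using integrable_pd)
    (by simpa using hw.continuous.integrable_of_hasCompactSupport hc) (by simp)
    fun x _ => hw.differentiable (by simp) x
  simpa [pd] using by_parts

lemma setIntegral_pd_eq_zero (hU : IsOpen U) (hK : IsCompact K) (hKU : K ⊆ U)
    (hw : ContDiffOn ℝ ∞ w U) (hw₀ : Set.EqOn w 0 (U \ K)) (i : Fin n) :
    IntegrableOn (pd i w) U ∧ ∫ z in U, pd i w z = 0 := by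
  have h₀ := eqOn_indicator_compl hw₀
  have hpd : Set.EqOn (pd i (U.indicator w)) (pd i w) U := eqOn_pd hU Set.eqOn_indicator i
  obtain ⟨hintegrable, hzero⟩ := integral_pd_eq_zero (contDiff_indicator hU hK.isClosed hKU hw hw₀)
    (HasCompactSupport.intro hK fun _ hz => h₀ hz) i
  refine ⟨hintegrable.integrableOn.congr_fun hpd hU.measurableSet, ?_⟩
  rw [← setIntegral_congr_fun hU.measurableSet hpd,
    setIntegral_eq_integral_of_forall_compl_eq_zero, hzero]
  intro z hz
  exact (eqOn_pd hK.isClosed.isOpen_compl h₀ i fun h => hz (hKU h)).trans (pd_const i 0)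

namespace IsMetricOn

lemma integral_divg_eq_zero (hG : IsMetricOn G U) (hK : IsCompact K) (hKU : K ⊆ U)
    (hX : ∀ i, ContDiffOn ℝ ∞ (X i) U) (hX₀ : ∀ i, Set.EqOn (X i) 0 (U \ K)) :
    ∫ z in U, √(G z).det * divg G X z = 0 := by
  have hpd := fun i => setIntegral_pd_eq_zero hG.isOpen hK hKU
    (hG.contDiffOn_sqrt_det.mul (hX i))
    (fun z hz => by simp [hX₀ i hz]) i
  rw [setIntegral_congr_fun hG.isOpen.measurableSet fun z hz =>
      hG.sqrt_det_mul_divg (fun i => hG.differentiableAt (hX i) hz) hz,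
    integral_finsetSum _ fun i _ => (hpd i).1]
  exact Finset.sum_eq_zero fun i _ => (hpd i).2

lemma integral_locH_mul_sub_energyDensity (hG : IsMetricOn G U) (hn : 2 < n) (hK : IsCompact K)
    (hKU : K ⊆ U) (hf : ContDiffOn ℝ ∞ f U) (hh : ContDiffOn ℝ ∞ h U)
    (hh₀ : Set.EqOn h 0 (U \ K)) :
    ∫ z in U, √(G z).det * (locH G lam f z * h z - energyDensity G lam f h z) = 0 := by
  rw [← hG.integral_divg_eq_zero hK hKU (hG.contDiffOn_fluxField hf hh lam)
    fun i z hz => fluxField_eq_zero (hG.isOpen.sdiff hK.isClosed) hh₀ hz lam f i]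
  exact setIntegral_congr_fun hG.isOpen.measurableSet fun z hz => by
    simp only [hG.locH_mul_eq hn hf hh hz, add_sub_cancel_left]

end IsMetricOn

end DivergenceTheorem

/-! ### The metric in charts -/

section Charts

variable {n : ℕ} {M : Type*} [TopologicalSpace M] [ChartedSpace (E n) M] {c c' x : M} {y : E n}

/-- The coordinate change from the chart at `c'` to the chart at `c`. -/
def coordChange (c' c : M) (y : E n) : E n :=
  extChartAt (𝓡 n) c ((extChartAt (𝓡 n) c').symm y)

/-- The domain of the coordinate change from the chart at `c'` to the chart at `c`. -/
def coordDomain (c' c : M) : Set (E n) :=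
  (extChartAt (𝓡 n) c').target ∩ (extChartAt (𝓡 n) c').symm ⁻¹' (extChartAt (𝓡 n) c).source

lemma isOpen_coordDomain (c' c : M) : IsOpen (coordDomain (n := n) c' c) :=
  (continuousOn_extChartAt_symm c').isOpen_inter_preimage (isOpen_extChartAt_target c')
    (isOpen_extChartAt_source c)

lemma mem_coordDomain (hx : x ∈ (extChartAt (𝓡 n) c).source) :
    extChartAt (𝓡 n) x x ∈ coordDomain (n := n) x c := by
  refine ⟨mem_extChartAt_target x, ?_⟩
  rwa [Set.mem_preimage, extChartAt_to_inv]

lemma coordChange_extChartAt (c x : M) :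
    coordChange x c (extChartAt (𝓡 n) x x) = extChartAt (𝓡 n) c x := by
  rw [coordChange, extChartAt_to_inv]

lemma symm_coordChange (hy : y ∈ coordDomain c' c) :
    (extChartAt (𝓡 n) c).symm (coordChange c' c y) = (extChartAt (𝓡 n) c').symm y :=
  (extChartAt (𝓡 n) c).left_inv hy.2

lemma coordChange_mem_target (hy : y ∈ coordDomain c' c) :
    coordChange c' c y ∈ (extChartAt (𝓡 n) c).target :=
  (extChartAt (𝓡 n) c).map_source hy.2

lemma coordChange_coordChange (hy : y ∈ coordDomain c' c) :
    coordChange c c' (coordChange c' c y) = y := by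
  rw [coordChange, symm_coordChange hy, (extChartAt (𝓡 n) c').right_inv hy.1]

lemma injOn_coordChange (c' c : M) : Set.InjOn (coordChange (n := n) c' c) (coordDomain c' c) :=
  Set.LeftInvOn.injOn (f₁' := coordChange c c') fun _ => coordChange_coordChange

lemma image_coordChange {s : Set M} (hs : s ⊆ (extChartAt (𝓡 n) c).source)
    (hs' : s ⊆ (extChartAt (𝓡 n) c').source) :
    coordChange c' c '' ((extChartAt (𝓡 n) c').symm ⁻¹' s ∩ (extChartAt (𝓡 n) c').target) =
      (extChartAt (𝓡 n) c).symm ⁻¹' s ∩ (extChartAt (𝓡 n) c).target := by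
  have mapsTo : ∀ {a b : M}, s ⊆ (extChartAt (𝓡 n) b).source →
      Set.MapsTo (coordChange a b)
        ((extChartAt (𝓡 n) a).symm ⁻¹' s ∩ (extChartAt (𝓡 n) a).target)
        ((extChartAt (𝓡 n) b).symm ⁻¹' s ∩ (extChartAt (𝓡 n) b).target) := fun hb y hy => by
    have hy' : y ∈ coordDomain _ _ := ⟨hy.2, hb hy.1⟩
    refine ⟨?_, coordChange_mem_target hy'⟩
    rw [Set.mem_preimage, symm_coordChange hy']
    exact hy.1
  refine (mapsTo hs).image_subset.antisymm fun z hz => ?_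
  exact ⟨coordChange c c' z, mapsTo hs' hz, coordChange_coordChange ⟨hz.2, hs' hz.1⟩⟩

variable [IsManifold (𝓡 n) ∞ M]

lemma contDiffOn_coordChange (c' c : M) :
    ContDiffOn ℝ ∞ (coordChange (n := n) c' c) (coordDomain c' c) := by
  rw [← contMDiffOn_iff_contDiffOn]
  refine (contMDiffOn_extChartAt (I := 𝓡 n) (n := ∞) (x := c)).comp
    ((contMDiffOn_extChartAt_symm c').mono Set.inter_subset_left) fun y hy => ?_
  simpa only [extChartAt_source] using hy.2

lemma contDiffOn_comp_chart_symm {φ : M → ℝ} (hφ : ContMDiff (𝓡 n) 𝓘(ℝ, ℝ) ∞ φ) (c : M) :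
    ContDiffOn ℝ ∞ (φ ∘ (extChartAt (𝓡 n) c).symm) (extChartAt (𝓡 n) c).target := by
  rw [← contMDiffOn_iff_contDiffOn]
  exact hφ.comp_contMDiffOn (contMDiffOn_extChartAt_symm c)

lemma contMDiffOn_coordVec (c : M) (i : Fin n) :
    ContMDiffOn 𝓘(ℝ, E n) (𝓡 n).tangent ∞
      (fun y => (⟨(extChartAt (𝓡 n) c).symm y, coordVec c i y⟩ : TangentBundle (𝓡 n) M))
      (extChartAt (𝓡 n) c).target := by
  have hopen := isOpen_extChartAt_target (I := 𝓡 n) c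
  have tangentMap := (contMDiffOn_extChartAt_symm (I := 𝓡 n)
    (n := ∞) c).contMDiffOn_tangentMapWithin (m := ∞) (by simp) hopen.uniqueMDiffOn
  have contMDiff_stdVec : ContMDiff 𝓘(ℝ, E n) (𝓘(ℝ, E n)).tangent ∞
      (fun y => (⟨y, stdVec i⟩ : TangentBundle 𝓘(ℝ, E n) (E n))) :=
    contMDiff_vectorSpace_iff_contDiff.2 contDiff_const
  refine (tangentMap.comp contMDiff_stdVec.contMDiffOn (s := (extChartAt (𝓡 n) c).target)
    fun y hy => hy).congr fun y hy => ?_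
  simp only [Function.comp, tangentMapWithin, coordVec]
  rw [mfderivWithin_of_isOpen hopen hy]

lemma mfderiv_chart_symm_injective (hy : y ∈ (extChartAt (𝓡 n) c).target) :
    Function.Injective (mfderiv 𝓘(ℝ, E n) (𝓡 n) (extChartAt (𝓡 n) c).symm y) := by
  have : IsManifold (𝓡 n) 1 M := IsManifold.of_le (n := ∞) (by simp)
  have invertible := isInvertible_mfderivWithin_extChartAt_symm (I := 𝓡 n) hy
  rw [modelWithCornersSelf_coe, Set.range_id, mfderivWithin_univ] at invertible
  exact invertible.injective

lemma mfderiv_chart_symm_eq_comp (hy : y ∈ coordDomain (n := n) c' c) (u : E n) :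
    (mfderiv 𝓘(ℝ, E n) (𝓡 n) (extChartAt (𝓡 n) c').symm y u : E n) =
      (mfderiv 𝓘(ℝ, E n) (𝓡 n) (extChartAt (𝓡 n) c).symm (coordChange c' c y)
        (fderiv ℝ (coordChange c' c) y u) : E n) := by
  have symm_eventuallyEq : (extChartAt (𝓡 n) c').symm =ᶠ[nhds y]
      (extChartAt (𝓡 n) c).symm ∘ coordChange (n := n) c' c := by
    filter_upwards [(isOpen_coordDomain c' c).mem_nhds hy] with z hz
    exact (symm_coordChange hz).symm
  have differentiable_symm : MDifferentiableAt 𝓘(ℝ, E n) (𝓡 n) (extChartAt (𝓡 n) c).symm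
      (coordChange c' c y) :=
    ((contMDiffOn_extChartAt_symm (n := ∞) c).contMDiffAt
      ((isOpen_extChartAt_target c).mem_nhds (coordChange_mem_target hy))).mdifferentiableAt
      (by simp)
  have differentiable_coordChange :
      MDifferentiableAt 𝓘(ℝ, E n) 𝓘(ℝ, E n) (coordChange (n := n) c' c) y :=
    (differentiableAt_of_contDiffOn (isOpen_coordDomain c' c) (contDiffOn_coordChange c' c)
      hy).mdifferentiableAt
  have chain_rule := symm_eventuallyEq.mfderiv_eq (I := 𝓘(ℝ, E n)) (I' := 𝓡 n)
  rw [mfderiv_comp y differentiable_symm differentiable_coordChange, mfderiv_eq_fderiv]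
    at chain_rule
  exact congrArg (fun L : E n →L[ℝ] E n => L u) chain_rule

variable (g : SmoothMetric n M)

lemma contDiffOn_metricInChart (c : M) (i j : Fin n) :
    ContDiffOn ℝ ∞ (fun y => metricInChart g c y i j) (extChartAt (𝓡 n) c).target := by
  rw [← contMDiffOn_iff_contDiffOn]
  have metric_section :
      ContMDiffOn 𝓘(ℝ, E n) ((𝓡 n).prod 𝓘(ℝ, E n →L[ℝ] E n →L[ℝ] ℝ)) ∞
      (fun y => Bundle.TotalSpace.mk' (E n →L[ℝ] E n →L[ℝ] ℝ)
        (E := fun x : M => TangentSpace (𝓡 n) x →L[ℝ] TangentSpace (𝓡 n) x →L[ℝ] ℝ)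
        ((extChartAt (𝓡 n) c).symm y) (g.inner ((extChartAt (𝓡 n) c).symm y)))
      (extChartAt (𝓡 n) c).target :=
    g.contMDiff.comp_contMDiffOn (contMDiffOn_extChartAt_symm c)
  have entry_section : ContMDiffOn 𝓘(ℝ, E n) ((𝓡 n).prod 𝓘(ℝ, ℝ)) ∞
      (fun y => Bundle.TotalSpace.mk' ℝ (E := Bundle.Trivial M ℝ) ((extChartAt (𝓡 n) c).symm y)
        (g.inner ((extChartAt (𝓡 n) c).symm y) (coordVec c i y) (coordVec c j y)))
      (extChartAt (𝓡 n) c).target :=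
    ContMDiffOn.clm_bundle_apply₂ (F₁ := E n) (F₂ := E n) metric_section
      (contMDiffOn_coordVec c i) (contMDiffOn_coordVec c j)
  exact fun y hy => ((Bundle.contMDiffWithinAt_totalSpace).1 (entry_section y hy)).2

lemma metricForm_metricInChart (c : M) (y u v : E n) :
    metricForm (metricInChart g c) y u v = g.inner ((extChartAt (𝓡 n) c).symm y)
      (mfderiv 𝓘(ℝ, E n) (𝓡 n) (extChartAt (𝓡 n) c).symm y u)
      (mfderiv 𝓘(ℝ, E n) (𝓡 n) (extChartAt (𝓡 n) c).symm y v) := by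
  let L : E n →L[ℝ] E n := mfderiv 𝓘(ℝ, E n) (𝓡 n) (extChartAt (𝓡 n) c).symm y
  let B : E n →L[ℝ] E n →L[ℝ] ℝ := g.inner ((extChartAt (𝓡 n) c).symm y)
  rw [metricForm_apply]
  exact (bilinear_apply_eq_sum (B.bilinearComp L L).toBilinForm u v).symm

lemma posDef_metricInChart (hy : y ∈ (extChartAt (𝓡 n) c).target) :
    (metricInChart g c y).PosDef := by
  refine Matrix.PosDef.of_dotProduct_mulVec_pos ?_ fun v hv => ?_
  · ext i j
    simp only [Matrix.conjTranspose_apply, star_trivial, metricInChart, Matrix.of_apply]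
    exact g.symm _ _ _
  · rw [star_dotProduct_mulVec_eq_metricForm, metricForm_metricInChart]
    refine g.pos _ _ fun h => hv ((WithLp.toLp_eq_zero 2).1 ?_)
    exact mfderiv_chart_symm_injective hy (h.trans (map_zero _).symm)

lemma isMetricOn_metricInChart (c : M) :
    IsMetricOn (metricInChart g c) (extChartAt (𝓡 n) c).target where
  isOpen := isOpen_extChartAt_target c
  contDiffOn := contDiffOn_metricInChart g c
  posDef _ := posDef_metricInChart g

lemma isPullback_coordChange (c' c : M) :
    IsPullback (coordChange c' c) (metricInChart g c') (coordDomain c' c) (metricInChart g c)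
      (extChartAt (𝓡 n) c).target where
  source := (isMetricOn_metricInChart g c').mono (isOpen_coordDomain c' c) Set.inter_subset_left
  target := isMetricOn_metricInChart g c
  contDiffOn := contDiffOn_coordChange c' c
  mapsTo _ := coordChange_mem_target
  entry y hy i j := by
    -- The two tangent spaces agree only propositionally, so the points must be generalized first.
    have inner_congr : ∀ (p q : M) (_ : p = q) (u v u' v' : E n) (_ : u = u') (_ : v = v'),
        g.inner p u v = g.inner q u' v' := by
      rintro p q rfl u v u' v' rfl rfl
      rfl
    rw [← metricForm_stdVec (G := metricInChart g c'), metricForm_metricInChart,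
      metricForm_metricInChart]
    exact inner_congr _ _ (symm_coordChange hy).symm _ _ _ _
      (mfderiv_chart_symm_eq_comp hy _) (mfderiv_chart_symm_eq_comp hy _)

end Charts

/-! ### The volume measure -/

section Volume

variable {n : ℕ}

lemma det_fderiv_eq_det_jac (Φ : E n → E n) (y : E n) :
    (fderiv ℝ Φ y).det = (jac Φ y).det := by
  rw [ContinuousLinearMap.det, ← LinearMap.det_toMatrix (EuclideanSpace.basisFun (Fin n) ℝ).toBasis]
  congr 1

lemma IsPullback.sqrt_det_eq {Φ : E n → E n} {G G' : E n → Matrix (Fin n) (Fin n) ℝ}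
    {U V : Set (E n)} (hP : IsPullback Φ G' V G U) {y : E n} (hy : y ∈ V) :
    √(G' y).det = |(fderiv ℝ Φ y).det| * √(G (Φ y)).det := by
  rw [hP.matrix_eq hy, Matrix.det_mul, Matrix.det_mul, Matrix.det_transpose,
    det_fderiv_eq_det_jac, ← Real.sqrt_sq_eq_abs, ← Real.sqrt_mul (sq_nonneg _)]
  ring_nf

variable {M : Type*} [TopologicalSpace M] [ChartedSpace (E n) M] [MeasurableSpace M]
  [BorelSpace M] {s : Set M}

lemma measurableSet_extChartAt_source (c : M) : MeasurableSet (extChartAt (𝓡 n) c).source :=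
  (isOpen_extChartAt_source c).measurableSet

lemma measurableSet_chart_preimage (c : M) (hs : MeasurableSet s) :
    MeasurableSet ((extChartAt (𝓡 n) c).symm ⁻¹' s ∩ (extChartAt (𝓡 n) c).target) := by
  have measurable_symm :
      Measurable ((extChartAt (𝓡 n) c).target.domRestrict (extChartAt (𝓡 n) c).symm) :=
    (continuousOn_iff_continuous_domRestrict.1 (continuousOn_extChartAt_symm c)).measurable
  have measurable_image := (isOpen_extChartAt_target (I := 𝓡 n) c).measurableSet.subtype_image
    (measurable_symm hs)
  rwa [Set.domRestrict_eq, Set.preimage_comp, Subtype.image_preimage_val, Set.inter_comm]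
    at measurable_image

variable [IsManifold (𝓡 n) ∞ M] (g : SmoothMetric n M)

lemma aemeasurable_chart_symm (c : M) : AEMeasurable (extChartAt (𝓡 n) c).symm
    (((volume : Measure (E n)).restrict (extChartAt (𝓡 n) c).target).withDensity
    (fun y => ENNReal.ofReal √(metricInChart g c y).det)) :=
  ((continuousOn_extChartAt_symm c).aemeasurable
    (isOpen_extChartAt_target c).measurableSet).mono_ac (withDensity_absolutelyContinuous _ _)

lemma chartVolume_apply (c : M) (hs : MeasurableSet s) :
    chartVolume g c s = ∫⁻ y in (extChartAt (𝓡 n) c).symm ⁻¹' s ∩ (extChartAt (𝓡 n) c).target,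
      ENNReal.ofReal √(metricInChart g c y).det := by
  rw [chartVolume, Measure.map_apply_of_aemeasurable (aemeasurable_chart_symm g c) hs,
    withDensity_apply', Measure.restrict_restrict' (isOpen_extChartAt_target c).measurableSet]

lemma chartVolume_inter_source (c : M) (hs : MeasurableSet s) :
    chartVolume g c (s ∩ (extChartAt (𝓡 n) c).source) = chartVolume g c s := by
  rw [chartVolume_apply g c (hs.inter (measurableSet_extChartAt_source c)),
    chartVolume_apply g c hs, Set.preimage_inter, Set.inter_assoc,
    Set.inter_eq_right.2 (extChartAt (𝓡 n) c).target_subset_preimage_source]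

lemma chartVolume_eq_of_subset (c c' : M) (hs : MeasurableSet s)
    (hc : s ⊆ (extChartAt (𝓡 n) c).source) (hc' : s ⊆ (extChartAt (𝓡 n) c').source) :
    chartVolume g c s = chartVolume g c' s := by
  have hP := isPullback_coordChange g c' c
  have hsub : (extChartAt (𝓡 n) c').symm ⁻¹' s ∩ (extChartAt (𝓡 n) c').target ⊆
      coordDomain (n := n) c' c := fun y hy => ⟨hy.2, hc hy.1⟩
  have hmeas := measurableSet_chart_preimage (n := n) c' hs
  rw [chartVolume_apply g c hs, chartVolume_apply g c' hs, ← image_coordChange hc hc',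
    lintegral_image_eq_lintegral_abs_det_fderiv_mul volume hmeas
      (fun y hy => (hP.differentiableAt (hsub hy)).hasFDerivAt.hasFDerivWithinAt)
      ((injOn_coordChange c' c).mono hsub)]
  exact setLIntegral_congr_fun hmeas fun y hy => by
    simp only [hP.sqrt_det_eq (hsub hy), ENNReal.ofReal_mul (abs_nonneg _)]

lemma chartVolume_inter_source_le (c c' : M) (hs : MeasurableSet s) :
    chartVolume g c' (s ∩ (extChartAt (𝓡 n) c).source) ≤ chartVolume g c s := by
  have hsrc := hs.inter (measurableSet_extChartAt_source (n := n) c)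
  rw [← chartVolume_inter_source g c' hsrc, chartVolume_eq_of_subset g c' c
    (hsrc.inter (measurableSet_extChartAt_source c')) Set.inter_subset_right fun x hx => hx.1.2]
  exact measure_mono fun x hx => hx.1.1

lemma vol_apply_of_subset (c : M) (hs : MeasurableSet s)
    (hc : s ⊆ (extChartAt (𝓡 n) c).source) : vol g s = chartVolume g c s := by
  have chartVolume_le : ∀ c', chartVolume g c' ≤ vol g := le_iSup (chartVolume g)
  refine le_antisymm ?_ (chartVolume_le c s)
  have vol_le : vol g ≤ (vol g).restrict (extChartAt (𝓡 n) c).sourceᶜ + chartVolume g c := by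
    refine iSup_le fun c' => Measure.le_iff.2 fun u hu => ?_
    rw [Measure.add_apply, Measure.restrict_apply hu,
      ← measure_inter_add_sdiff u (measurableSet_extChartAt_source (n := n) c), add_comm,
      ← Set.sdiff_eq]
    exact add_le_add (chartVolume_le c' _) (chartVolume_inter_source_le g c c' hu)
  refine (vol_le s).trans_eq ?_
  rw [Measure.add_apply, Measure.restrict_apply hs, ← Set.sdiff_eq, Set.sdiff_eq_empty.2 hc,
    measure_empty, zero_add]

lemma vol_restrict_source (c : M) :
    (vol g).restrict (extChartAt (𝓡 n) c).source = chartVolume g c := by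
  ext s hs
  rw [Measure.restrict_apply hs, vol_apply_of_subset g c
    (hs.inter (measurableSet_extChartAt_source c)) Set.inter_subset_right,
    chartVolume_inter_source g c hs]

lemma integral_vol_of_eqOn_compl {F : M → ℝ} (hF : Continuous F) (c : M)
    (hc : Set.EqOn F 0 (extChartAt (𝓡 n) c).sourceᶜ) :
    ∫ x, F x ∂(vol g) = ∫ y in (extChartAt (𝓡 n) c).target,
      √(metricInChart g c y).det * F ((extChartAt (𝓡 n) c).symm y) := by
  have measurable_density : AEMeasurable (fun y => ENNReal.ofReal √(metricInChart g c y).det)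
      (volume.restrict (extChartAt (𝓡 n) c).target) :=
    ((isMetricOn_metricInChart g c).contDiffOn_sqrt_det.continuousOn.aemeasurable
      (isOpen_extChartAt_target c).measurableSet).ennreal_ofReal
  rw [← setIntegral_eq_integral_of_forall_compl_eq_zero fun _ hx => hc hx, vol_restrict_source,
    chartVolume, integral_map (aemeasurable_chart_symm g c) hF.aestronglyMeasurable,
    integral_withDensity_eq_integral_toReal_smul₀ measurable_density
      (Filter.Eventually.of_forall fun y => ENNReal.ofReal_lt_top)]
  simp only [ENNReal.toReal_ofReal (Real.sqrt_nonneg _), smul_eq_mul]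

instance isLocallyFiniteMeasure_vol : IsLocallyFiniteMeasure (vol g) where
  finiteAtNhds x := by
    obtain ⟨r, hr, hball⟩ := Metric.nhds_basis_closedBall.mem_iff.1
      ((isOpen_extChartAt_target (I := 𝓡 n) x).mem_nhds (mem_extChartAt_target x))
    let N : Set M := (extChartAt (𝓡 n) x).source ∩
      extChartAt (𝓡 n) x ⁻¹' Metric.ball (extChartAt (𝓡 n) x x) r
    have hN : IsOpen N := (continuousOn_extChartAt x).isOpen_inter_preimage
      (isOpen_extChartAt_source x) Metric.isOpen_ball
    refine ⟨N, hN.mem_nhds ⟨mem_extChartAt_source x, Metric.mem_ball_self hr⟩, ?_⟩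
    have hsub : (extChartAt (𝓡 n) x).symm ⁻¹' N ∩ (extChartAt (𝓡 n) x).target ⊆
        Metric.closedBall (extChartAt (𝓡 n) x x) r := fun y hy => by
      rw [← (extChartAt (𝓡 n) x).right_inv hy.2]
      exact Metric.ball_subset_closedBall hy.1.2
    have integrable_density : IntegrableOn (fun y => √(metricInChart g x y).det)
        (Metric.closedBall (extChartAt (𝓡 n) x x) r) :=
      ((isMetricOn_metricInChart g x).contDiffOn_sqrt_det.continuousOn.mono
        hball).integrableOn_compact (isCompact_closedBall _ _)
    rw [vol_apply_of_subset g x hN.measurableSet Set.inter_subset_left,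
      chartVolume_apply g x hN.measurableSet]
    exact (lintegral_mono_set hsub).trans_lt integrable_density.lintegral_lt_top

end Volume

/-! ### Integration on the manifold -/

section Globalization

variable {F H' N A ι : Type*} [NormedAddCommGroup F] [NormedSpace ℝ F] [FiniteDimensional ℝ F]
  [TopologicalSpace H'] {I : ModelWithCorners ℝ F H'} [TopologicalSpace N] [ChartedSpace H' N]
  [IsManifold I ∞ N] [T2Space N] [CompactSpace N] [AddCommMonoid A]

lemma addMonoidHom_eq_zero_of_openCover {U : ι → Set N} (hU : ∀ i, IsOpen (U i))
    (hcover : Set.univ ⊆ ⋃ i, U i) (L : C^∞⟮I, N; 𝓘(ℝ, ℝ), ℝ⟯ →+ A)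
    (hL : ∀ i (χ : C^∞⟮I, N; 𝓘(ℝ, ℝ), ℝ⟯), tsupport χ ⊆ U i → L χ = 0) : L = 0 := by
  obtain ⟨ρ, hρ⟩ := SmoothPartitionOfUnity.exists_isSubordinate I isClosed_univ U hU hcover
  have finite_support := ρ.locallyFinite.finite_nonempty_of_compact
  have sum_eq_one : ∑ i ∈ finite_support.toFinset, ρ i = 1 := by
    ext x
    rw [ContMDiffMap.coe_one, Pi.one_apply, ← ρ.sum_eq_one (Set.mem_univ x)]
    refine (map_sum (ContMDiffMap.evalRingHom x) _ _).trans ?_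
    exact (finsum_eq_sum_of_support_subset _ fun i hi =>
      finite_support.mem_toFinset.2 ⟨x, hi⟩).symm
  ext χ
  rw [← one_mul χ, ← sum_eq_one, Finset.sum_mul, map_sum, AddMonoidHom.zero_apply]
  exact Finset.sum_eq_zero fun i _ => hL i _ ((tsupport_mul_subset_left (f := ρ i)).trans (hρ i))

end Globalization

section Global

variable {n : ℕ} {M : Type*} [TopologicalSpace M] [ChartedSpace (E n) M]

lemma continuous_of_charts {F : M → ℝ} (hF : ∀ c : M, ∃ F' : E n → ℝ,
    ContinuousOn F' (extChartAt (𝓡 n) c).target ∧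
      Set.EqOn F (F' ∘ extChartAt (𝓡 n) c) (extChartAt (𝓡 n) c).source) : Continuous F := by
  refine continuous_iff_continuousAt.2 fun x => ?_
  obtain ⟨F', hF', hFF'⟩ := hF x
  exact ((hF'.comp (continuousOn_extChartAt x) (extChartAt (𝓡 n) x).mapsTo).congr
    hFF').continuousAt ((isOpen_extChartAt_source x).mem_nhds (mem_extChartAt_source x))

lemma comp_chart_symm_eqOn (φ : M → ℝ) (c' c : M) :
    Set.EqOn (φ ∘ (extChartAt (𝓡 n) c').symm)
      (fun z => (φ ∘ (extChartAt (𝓡 n) c).symm) (coordChange c' c z)) (coordDomain c' c) :=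
  fun _ hz => congrArg φ (symm_coordChange hz).symm

variable [IsManifold (𝓡 n) ∞ M] (g : SmoothMetric n M) {φ ψ χ : M → ℝ} {c x : M} (lam : ℝ)

/-- The symmetric bilinear form that represents `∫ Hφ · ψ`, as a function on `M`; it is computed
in the preferred chart at each point. -/
def energy (φ ψ : M → ℝ) (x : M) : ℝ :=
  energyDensity (metricInChart g x) lam (φ ∘ (extChartAt (𝓡 n) x).symm)
    (ψ ∘ (extChartAt (𝓡 n) x).symm) (extChartAt (𝓡 n) x x)

lemma Q_eq (hx : x ∈ (extChartAt (𝓡 n) c).source) :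
    Q g x = locQ (metricInChart g c) (extChartAt (𝓡 n) c x) := by
  rw [Q, (isPullback_coordChange g x c).locQ_eq (mem_coordDomain hx), coordChange_extChartAt]

lemma sigmaTwo_eq (hx : x ∈ (extChartAt (𝓡 n) c).source) :
    sigmaTwo g x = locSigmaTwo (metricInChart g c) (extChartAt (𝓡 n) c x) := by
  rw [sigmaTwo, (isPullback_coordChange g x c).locSigmaTwo_eq (mem_coordDomain hx),
    coordChange_extChartAt]

lemma H_eq (hφ : ContMDiff (𝓡 n) 𝓘(ℝ, ℝ) ∞ φ) (hx : x ∈ (extChartAt (𝓡 n) c).source) :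
    H g lam φ x = locH (metricInChart g c) lam (φ ∘ (extChartAt (𝓡 n) c).symm)
      (extChartAt (𝓡 n) c x) := by
  rw [H, (isPullback_coordChange g x c).locH_eq (contDiffOn_comp_chart_symm hφ c)
    (comp_chart_symm_eqOn φ x c) (mem_coordDomain hx), coordChange_extChartAt]

lemma energy_eq (hφ : ContMDiff (𝓡 n) 𝓘(ℝ, ℝ) ∞ φ) (hψ : ContMDiff (𝓡 n) 𝓘(ℝ, ℝ) ∞ ψ)
    (hx : x ∈ (extChartAt (𝓡 n) c).source) :
    energy g lam φ ψ x = energyDensity (metricInChart g c) lam (φ ∘ (extChartAt (𝓡 n) c).symm)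
      (ψ ∘ (extChartAt (𝓡 n) c).symm) (extChartAt (𝓡 n) c x) := by
  rw [energy, (isPullback_coordChange g x c).energyDensity_eq (contDiffOn_comp_chart_symm hφ c)
    (comp_chart_symm_eqOn φ x c) (contDiffOn_comp_chart_symm hψ c) (comp_chart_symm_eqOn ψ x c)
    (mem_coordDomain hx), coordChange_extChartAt]

lemma continuous_H (hφ : ContMDiff (𝓡 n) 𝓘(ℝ, ℝ) ∞ φ) : Continuous (H g lam φ) :=
  continuous_of_charts fun c => ⟨_, ((isMetricOn_metricInChart g c).contDiffOn_locH
    (contDiffOn_comp_chart_symm hφ c) lam).continuousOn, fun _ hx => H_eq g lam hφ hx⟩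

lemma continuous_energy (hφ : ContMDiff (𝓡 n) 𝓘(ℝ, ℝ) ∞ φ) (hψ : ContMDiff (𝓡 n) 𝓘(ℝ, ℝ) ∞ ψ) :
    Continuous (energy g lam φ ψ) :=
  continuous_of_charts fun c => ⟨_, ((isMetricOn_metricInChart g c).contDiffOn_energyDensity
    (contDiffOn_comp_chart_symm hφ c) (contDiffOn_comp_chart_symm hψ c) lam).continuousOn,
    fun _ hx => energy_eq g lam hφ hψ hx⟩

lemma continuous_Q_sub : Continuous fun x => Q g x - lam * sigmaTwo g x :=
  continuous_of_charts fun c => ⟨_,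
    ((isMetricOn_metricInChart g c).contDiffOn_locQ_sub lam).continuousOn,
    fun x hx => by simp only [Q_eq g hx, sigmaTwo_eq g hx, Function.comp_apply]⟩

lemma energy_comm (φ ψ : M → ℝ) (x : M) : energy g lam φ ψ x = energy g lam ψ φ x :=
  (isMetricOn_metricInChart g x).energyDensity_comm (mem_extChartAt_target x) lam _ _

lemma energy_add (hψ : ContMDiff (𝓡 n) 𝓘(ℝ, ℝ) ∞ ψ) (hχ : ContMDiff (𝓡 n) 𝓘(ℝ, ℝ) ∞ χ)
    (φ : M → ℝ) (x : M) :
    energy g lam φ (ψ + χ) x = energy g lam φ ψ x + energy g lam φ χ x :=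
  (isMetricOn_metricInChart g x).energyDensity_add (contDiffOn_comp_chart_symm hψ x)
    (contDiffOn_comp_chart_symm hχ x) (mem_extChartAt_target x) lam _

lemma energy_eq_zero (hx : x ∉ tsupport ψ) : energy g lam φ ψ x = 0 := by
  refine energyDensity_eq_zero (V := (extChartAt (𝓡 n) x).target ∩
    (extChartAt (𝓡 n) x).symm ⁻¹' (tsupport ψ)ᶜ) ?_ (fun z hz => ?_)
    ⟨mem_extChartAt_target x, ?_⟩ lam _
  · exact (continuousOn_extChartAt_symm x).isOpen_inter_preimage (isOpen_extChartAt_target x)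
      (isClosed_tsupport ψ).isOpen_compl
  · exact image_eq_zero_of_notMem_tsupport (f := ψ) hz.2
  · rwa [Set.mem_preimage, extChartAt_to_inv]

variable [CompactSpace M]

lemma exists_pos_le_Q_sub (hQ : ∀ x : M, 0 < Q g x - lam * sigmaTwo g x) :
    ∃ m : ℝ, 0 < m ∧ ∀ x : M, m ≤ Q g x - lam * sigmaTwo g x := by
  obtain ⟨m, hm, hle⟩ := isCompact_univ.exists_forall_le'
    (continuous_Q_sub g lam).continuousOn fun x _ => hQ x
  exact ⟨m, hm, fun x => hle x (Set.mem_univ x)⟩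

variable [MeasurableSpace M] [BorelSpace M]

lemma integrable_vol {F : M → ℝ} (hF : Continuous F) : Integrable F (vol g) :=
  hF.integrable_of_hasCompactSupport (HasCompactSupport.of_compactSpace F)

lemma integral_H_mul_sub_energy_of_tsupport_subset (hn : 2 < n)
    (hφ : ContMDiff (𝓡 n) 𝓘(ℝ, ℝ) ∞ φ) (hψ : ContMDiff (𝓡 n) 𝓘(ℝ, ℝ) ∞ ψ)
    (hc : tsupport ψ ⊆ (extChartAt (𝓡 n) c).source) :
    ∫ x, (H g lam φ x * ψ x - energy g lam φ ψ x) ∂(vol g) = 0 := by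
  have hK : IsCompact (extChartAt (𝓡 n) c '' tsupport ψ) :=
    (isClosed_tsupport ψ).isCompact.image_of_continuousOn ((continuousOn_extChartAt c).mono hc)
  have hKU : extChartAt (𝓡 n) c '' tsupport ψ ⊆ (extChartAt (𝓡 n) c).target :=
    ((extChartAt (𝓡 n) c).mapsTo.mono_left hc).image_subset
  have eqOn_zero : Set.EqOn (ψ ∘ (extChartAt (𝓡 n) c).symm) 0
      ((extChartAt (𝓡 n) c).target \ extChartAt (𝓡 n) c '' tsupport ψ) := fun z hz =>
    image_eq_zero_of_notMem_tsupport (f := ψ) fun hmem =>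
      hz.2 ⟨_, hmem, (extChartAt (𝓡 n) c).right_inv hz.1⟩
  have continuous_defect : Continuous fun x => H g lam φ x * ψ x - energy g lam φ ψ x :=
    ((continuous_H g lam hφ).mul hψ.continuous).sub (continuous_energy g lam hφ hψ)
  rw [integral_vol_of_eqOn_compl g continuous_defect c fun x hx => ?_,
    ← (isMetricOn_metricInChart g c).integral_locH_mul_sub_energyDensity (lam := lam) hn hK hKU
      (contDiffOn_comp_chart_symm hφ c) (contDiffOn_comp_chart_symm hψ c) eqOn_zero]
  · refine setIntegral_congr_fun (isOpen_extChartAt_target c).measurableSet fun y hy => ?_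
    have hsource := (extChartAt (𝓡 n) c).map_target hy
    simp only [H_eq g lam hφ hsource, energy_eq g lam hφ hψ hsource,
      (extChartAt (𝓡 n) c).right_inv hy, Function.comp_apply]
  · have hx' : x ∉ tsupport ψ := fun hmem => hx (hc hmem)
    simp only [energy_eq_zero g lam hx', image_eq_zero_of_notMem_tsupport hx', mul_zero, sub_zero,
      Pi.zero_apply]

variable [T2Space M]

lemma integral_H_mul_eq (hn : 2 < n) (hφ : ContMDiff (𝓡 n) 𝓘(ℝ, ℝ) ∞ φ)
    (hψ : ContMDiff (𝓡 n) 𝓘(ℝ, ℝ) ∞ ψ) :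
    ∫ x, H g lam φ x * ψ x ∂(vol g) = ∫ x, energy g lam φ ψ x ∂(vol g) := by
  have integrable_defect : ∀ {χ : M → ℝ}, ContMDiff (𝓡 n) 𝓘(ℝ, ℝ) ∞ χ →
      Integrable (fun x => H g lam φ x * χ x - energy g lam φ χ x) (vol g) := fun hχ =>
    integrable_vol g (((continuous_H g lam hφ).mul hχ.continuous).sub
      (continuous_energy g lam hφ hχ))
  let defect : C^∞⟮𝓡 n, M; 𝓘(ℝ, ℝ), ℝ⟯ →+ ℝ :=
    AddMonoidHom.mk' (fun χ => ∫ x, (H g lam φ x * χ x - energy g lam φ χ x) ∂(vol g))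
      fun χ ξ => by
        rw [← integral_add (integrable_defect χ.contMDiff) (integrable_defect ξ.contMDiff)]
        refine integral_congr_ae (Filter.Eventually.of_forall fun x => ?_)
        simp only [ContMDiffMap.coe_add, Pi.add_apply,
          energy_add g lam χ.contMDiff ξ.contMDiff φ x]
        ring
  have defect_eq_zero : defect = 0 := addMonoidHom_eq_zero_of_openCover
    (fun c : M => isOpen_extChartAt_source (I := 𝓡 n) c)
    (fun x _ => Set.mem_iUnion_of_mem x (mem_extChartAt_source x)) defect
    fun _ χ hχ => integral_H_mul_sub_energy_of_tsupport_subset g lam hn hφ χ.contMDiff hχ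
  have integral_sub_eq_zero := DFunLike.congr_fun defect_eq_zero ⟨ψ, hψ⟩
  exact sub_eq_zero.1 ((integral_sub
    (integrable_vol g ((continuous_H g lam hφ).mul hψ.continuous))
    (integrable_vol g (continuous_energy g lam hφ hψ))).symm.trans integral_sub_eq_zero)

lemma integral_H_mul_comm (hn : 2 < n) (hφ : ContMDiff (𝓡 n) 𝓘(ℝ, ℝ) ∞ φ)
    (hψ : ContMDiff (𝓡 n) 𝓘(ℝ, ℝ) ∞ ψ) :
    ∫ x, H g lam φ x * ψ x ∂(vol g) = ∫ x, φ x * H g lam ψ x ∂(vol g) := by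
  simp only [mul_comm (φ _)]
  rw [integral_H_mul_eq g lam hn hφ hψ, integral_H_mul_eq g lam hn hψ hφ]
  simp only [energy_comm g lam φ ψ]

lemma mul_integral_sq_le (hn : 4 ≤ n) (hφ : ContMDiff (𝓡 n) 𝓘(ℝ, ℝ) ∞ φ) {m : ℝ}
    (hm : ∀ x : M, m ≤ Q g x - lam * sigmaTwo g x) (hJ : ∀ x : M, 0 ≤ J g x)
    (ht₀ : 0 ≤ hessWeight n lam) (ht₁ : hessWeight n lam ≤ 1)
    (hgrad : 0 ≤ hessWeight n lam + (n - 2 - lam)) :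
    ((n : ℝ) - 4) / 2 * m * ∫ x, φ x ^ 2 ∂(vol g) ≤ ∫ x, H g lam φ x * φ x ∂(vol g) := by
  have hn' : (4 : ℝ) ≤ n := by exact_mod_cast hn
  rw [integral_H_mul_eq g lam (by lia) hφ hφ, ← integral_const_mul]
  refine integral_mono (integrable_vol g (continuous_const.mul (hφ.continuous.pow 2)))
    (integrable_vol g (continuous_energy g lam hφ hφ)) fun x => ?_
  have energy_ge := (isMetricOn_metricInChart g x).le_energyDensity_self
    (contDiffOn_comp_chart_symm hφ x) (mem_extChartAt_target x) (hJ x) ht₀ ht₁ hgrad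
  rw [Function.comp_apply, extChartAt_to_inv] at energy_ge
  refine le_trans ?_ energy_ge
  exact mul_le_mul_of_nonneg_right
    (mul_le_mul_of_nonneg_left (hm x) (by linarith)) (sq_nonneg (φ x))

end Global

end PaneitzH

end

theorem lemma2p1_general (n : ℕ) (hn : 5 ≤ n)
    (M : Type*) [TopologicalSpace M] [T2Space M] [CompactSpace M]
    [ChartedSpace (EuclideanSpace ℝ (Fin n)) M] [IsManifold (𝓡 n) ∞ M]
    [MeasurableSpace M] [BorelSpace M]
    (g : PaneitzH.SmoothMetric n M)
    (lam : ℝ) (hlam₄ : lam ≤ 4) (hlam_lower : 6 - (n : ℝ) ≤ lam)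
    (hlam_upper : ((n : ℝ) - 1) * lam ≤ ((n : ℝ) - 2) ^ 2 + 4)
    (hQ : ∀ x : M, 0 < PaneitzH.Q g x - lam * PaneitzH.sigmaTwo g x)
    (hJ : ∀ x : M, 0 ≤ PaneitzH.J g x) :
    PaneitzH.IsPositiveDefinite g (PaneitzH.H g lam) := by
  have hn' : (5 : ℝ) ≤ n := by exact_mod_cast hn
  have hweight := PaneitzH.hessWeight_mul (n := n) (by lia) lam
  have ht₀ : 0 ≤ PaneitzH.hessWeight n lam := by nlinarith
  have ht₁ : PaneitzH.hessWeight n lam ≤ 1 := by nlinarith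
  have hgrad : 0 ≤ PaneitzH.hessWeight n lam + (n - 2 - lam) := by nlinarith
  obtain ⟨m, hm, hle⟩ := PaneitzH.exists_pos_le_Q_sub g lam hQ
  exact ⟨fun φ ψ hφ hψ => PaneitzH.integral_H_mul_comm g lam (by lia) hφ hψ,
    ((n : ℝ) - 4) / 2 * m, mul_pos (by linarith) hm,
    fun φ hφ => PaneitzH.mul_integral_sq_le g lam (by lia) hφ hle hJ ht₀ ht₁ hgrad⟩

theorem lemma2p1 (n : ℕ) (hn : 6 ≤ n)
    (M : Type*) [TopologicalSpace M] [T2Space M] [CompactSpace M]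
    [ChartedSpace (EuclideanSpace ℝ (Fin n)) M] [IsManifold (𝓡 n) ∞ M]
    [MeasurableSpace M] [BorelSpace M]
    (g : PaneitzH.SmoothMetric n M)
    (lam : ℝ) (hlam₀ : 0 ≤ lam) (hlam₄ : lam ≤ 4)
    (hQ : ∀ x : M, 0 < PaneitzH.Q g x - lam * PaneitzH.sigmaTwo g x)
    (hJ : ∀ x : M, 0 < PaneitzH.J g x) :
    PaneitzH.IsPositiveDefinite g (PaneitzH.H g lam) := by
  have hn' : (6 : ℝ) ≤ n := by exact_mod_cast hn
  exact lemma2p1_general n (by lia) M g lam hlam₄ (by linarith) (by nlinarith) hQ fun x => (hJ x).le
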